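/- **Setting.** There are $K\ge 1$ arms and a horizon $T\ge 2$. The pairs $(r_t(\cdot),d_t(\cdot))$, $t=1,2,\dots$, of a reward vector $r_t\in[0,1]^K$ and a delay vector $d_t\in(\mathbb N\cup\{\infty\})^K$ are i.i.d. over $t$, and within a round $r_t(\cdot)$ and $d_t(\cdot)$ are independent of each other (reward-independent delays; the delays may be unbounded or infinite, and the arms of one round may be dependent). If arm $a_t$ is pulled in round $t$, the pair $(a_t,r_t(a_t))$ is observed at the end of round $t+d_t(a_t)$ (never, if the delay is infinite). Let $\mu_i=\mathbb E[r_t(i)]$, let $i^*$ be an optimal arm, $\Delta_i=\mu_{i^*}-\mu_i$, and let $$d_i(q)=\min\{\gamma\in\mathbb N: \Pr[d_t(i)\le\gamma]\ge q\},\qquad d_i(q)=\infty\text{ if there is no such }\gamma .$$ The expected pseudo-regret is $$\mathcal R_T=\max_i\mathbb E\Big[\sum_{t=1}^T r_t(i)\Big]-\mathbb E\Big[\sum_{t=1}^T r_t(a_t)\Big].$$ **Algorithm (Successive Elimination with delays).** Put $$n_t(i)=\sum_{s:\,s+d_s(a_s)<t}\mathbf 1\{a_s=i\},\qquad \hat\mu_t(i)=\frac1{n_t(i)\vee1}\sum_{s:\,s+d_s(a_s)<t}\mathbf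 1\{a_s=i\}\,r_s(a_s),$$ and let $UCB_t(i)$ and $LCB_t(i)$ be $\hat\mu_t(i)+\sqrt{2\log T/(n_t(i)\vee1)}$ and $\hat\mu_t(i)-\sqrt{2\log T/(n_t(i)\vee1)}$, respectively. Start with the active set $S=[K]$. Repeatedly pull every arm of $S$ once (one arm per round, in an order fixed in advance, which may depend on $S$ and on the number of the pass), and then, at the beginning $t$ of the next round, remove from $S$ every $i$ for which some $j\in S$ has $UCB_t(i)<LCB_t(j)$. The last pass is cut off after round $T$. **Theorem.** The expected pseudo-regret of this algorithm satisfies $$\mathcal R_T\le\min_{\vec q\in(0,1]^K}\ \sum_{i\ne i^*}\frac{40\log T}{\Delta_i}\Big(\frac1{q_i}+\frac1{q_{i^*}}\Big)+\log(K)\,\max_{i\ne i^*}\big\{(d_i(q_i)+d_{i^*}(q_{i^*}))\,\Delta_i\big\},$$ and, with a single quantile, $$\mathcal R_T\le\min_{q\in(0,1]}\ \sum_{i\ne i^*}\frac{325\log T}{q\,\Delta_i}+4\max_{i\in[K]}d_i(q).$$ Each minimum is over the whole expression to its right and is understood as an infimum in $[0,\infty]$, with the conventions that $c/0=\infty$ for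 $c>0$, $0\cdot\infty=0$, and that an empty maximum is $0$. -/

import Mathlib

open MeasureTheory ProbabilityTheory
open scoped ENNReal

namespace DelayedBandit

noncomputable section

/-! Rounds are indexed by `t = 0, 1, 2, …`; a horizon `T` consists of the rounds `t < T`. -/

/-- Number of feedback items from arm `i` observed strictly before round `t`, when arm `a s` is
pulled in round `s` and the delay vector of round `s` is `d s`. -/
def numObs {K : ℕ} (d : ℕ → Fin K → ℕ∞) (a : ℕ → Fin K) (t : ℕ) (i : Fin K) : ℕ :=
  ((Finset.range t).filter (fun s => a s = i ∧ (s : ℕ∞) + d s (a s) < (t : ℕ∞))).card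

/-- Observed empirical mean of arm `i` before round `t`. -/
def empMean {K : ℕ} (r : ℕ → Fin K → ℝ) (d : ℕ → Fin K → ℕ∞) (a : ℕ → Fin K) (t : ℕ)
    (i : Fin K) : ℝ :=
  (∑ s ∈ (Finset.range t).filter (fun s => a s = i ∧ (s : ℕ∞) + d s (a s) < (t : ℕ∞)), r s (a s)) /
    ((max (numObs d a t i) 1 : ℕ) : ℝ)

/-- Confidence radius `√(2 log T / (n_t(i) ∨ 1))`. -/
def radius {K : ℕ} (T : ℕ) (d : ℕ → Fin K → ℕ∞) (a : ℕ → Fin K) (t : ℕ) (i : Fin K) : ℝ :=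
  Real.sqrt (2 * Real.log T / ((max (numObs d a t i) 1 : ℕ) : ℝ))

/-- Lower confidence bound. -/
def lcb {K : ℕ} (T : ℕ) (r : ℕ → Fin K → ℝ) (d : ℕ → Fin K → ℕ∞) (a : ℕ → Fin K) (t : ℕ)
    (i : Fin K) : ℝ :=
  empMean r d a t i - radius T d a t i

/-- Upper confidence bound. -/
def ucb {K : ℕ} (T : ℕ) (r : ℕ → Fin K → ℝ) (d : ℕ → Fin K → ℕ∞) (a : ℕ → Fin K) (t : ℕ)
    (i : Fin K) : ℝ :=
  empMean r d a t i + radius T d a t i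

/-- Elimination step: the arms of `S` that are kept, the confidence bounds being computed at the
beginning of round `t`. -/
def keep {K : ℕ} (T : ℕ) (r : ℕ → Fin K → ℝ) (d : ℕ → Fin K → ℕ∞) (a : ℕ → Fin K) (t : ℕ)
    (S : Finset (Fin K)) : Finset (Fin K) :=
  S.filter (fun i => ¬ ∃ j ∈ S, ucb T r d a t i < lcb T r d a t j)

/-- Internal state of Successive Elimination at the beginning of a round. -/
structure SEState (K : ℕ) where
  /-- number of completed passes over the active arms -/
  pass : ℕ
  /-- active arms -/
  active : Finset (Fin K)
  /-- active arms that still have to be pulled in the current pass, in this order -/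
  queue : List (Fin K)
  /-- arms pulled in the earlier rounds (the value at the present and later rounds is irrelevant) -/
  pulled : ℕ → Fin K

/-- `ord n S` is the order in which the active arms `S` are pulled in pass number `n`. -/
def IsPullOrder {K : ℕ} (ord : ℕ → Finset (Fin K) → List (Fin K)) : Prop :=
  ∀ n S, (ord n S).Nodup ∧ (ord n S).toFinset = S

/-- The arm pulled in a given state (the queue is never empty, see `queue_ne_nil`). -/
def SEState.next {K : ℕ} [NeZero K] (x : SEState K) : Fin K := x.queue.headD 0

/-- Round `t` of Successive Elimination with delays and horizon `T`: pull the next arm of the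
current pass; if the pass is then complete, perform an elimination step and start a new pass. -/
def seStep {K : ℕ} [NeZero K] (T : ℕ) (ord : ℕ → Finset (Fin K) → List (Fin K))
    (r : ℕ → Fin K → ℝ) (d : ℕ → Fin K → ℕ∞) (t : ℕ) (x : SEState K) : SEState K :=
  let a : ℕ → Fin K := Function.update x.pulled t x.next
  if x.queue.tail = [] then
    let S := keep T r d a (t + 1) x.active
    { pass := x.pass + 1, active := S, queue := ord (x.pass + 1) S, pulled := a }
  else
    { pass := x.pass, active := x.active, queue := x.queue.tail, pulled := a }

/-- State of Successive Elimination at the beginning of round `t`, on the realization `r`, `d` of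
the rewards and the delays. -/
def seState {K : ℕ} [NeZero K] (T : ℕ) (ord : ℕ → Finset (Fin K) → List (Fin K))
    (r : ℕ → Fin K → ℝ) (d : ℕ → Fin K → ℕ∞) : ℕ → SEState K
  | 0 => { pass := 0, active := Finset.univ, queue := ord 0 Finset.univ, pulled := fun _ => 0 }
  | t + 1 => seStep T ord r d t (seState T ord r d t)

/-- The arm pulled in round `t` by Successive Elimination. -/
def seArm {K : ℕ} [NeZero K] (T : ℕ) (ord : ℕ → Finset (Fin K) → List (Fin K))
    (r : ℕ → Fin K → ℝ) (d : ℕ → Fin K → ℕ∞) (t : ℕ) : Fin K :=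
  (seState T ord r d t).next

/-- Stochastic bandit with delayed feedback, rewards in `[0,1]` and reward-independent delays:
the pairs (reward vector, delay vector) of the rounds are i.i.d., and in each round the two vectors
are independent of each other. (The arms of one round may be dependent.) -/
structure IsRewardIndepDelayedBandit {Ω : Type*} [MeasurableSpace Ω] (P : Measure Ω) {K : ℕ}
    (r : ℕ → Ω → Fin K → ℝ) (d : ℕ → Ω → Fin K → ℕ∞) : Prop where
  measurable_reward : ∀ t, Measurable (r t)
  measurable_delay : ∀ t, Measurable (d t)
  reward_mem : ∀ t, ∀ᵐ ω ∂P, ∀ i, r t ω i ∈ Set.Icc (0 : ℝ) 1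
  iIndep : iIndepFun (fun t ω => (r t ω, d t ω)) P
  identDistrib : ∀ t, IdentDistrib (fun ω => (r t ω, d t ω)) (fun ω => (r 0 ω, d 0 ω)) P P
  rewardIndep : ∀ t, IndepFun (r t) (d t) P

/-- Mean reward of arm `i`. -/
def meanReward {Ω : Type*} [MeasurableSpace Ω] (P : Measure Ω) {K : ℕ} (r : ℕ → Ω → Fin K → ℝ)
    (i : Fin K) : ℝ :=
  ∫ ω, r 0 ω i ∂P

/-- The quantile function `d_i(q) = min {γ ∈ ℕ | Pr[D_i ≤ γ] ≥ q}` of the delay of arm `i`; it is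
`∞` if there is no such `γ`. -/
def delayQuantile {Ω : Type*} [MeasurableSpace Ω] (P : Measure Ω) {K : ℕ}
    (d : ℕ → Ω → Fin K → ℕ∞) (i : Fin K) (q : ℝ) : ℕ∞ :=
  sInf ((fun γ : ℕ => (γ : ℕ∞)) '' {γ : ℕ | q ≤ P.real {ω | d 0 ω i ≤ (γ : ℕ∞)}})

/-- Expected pseudo-regret over the rounds `t < T` of the random sequence of arms `a`:
`max_i E[∑ r_t(i)] - E[∑ r_t(a_t)]`. -/
def pseudoRegret {Ω : Type*} [MeasurableSpace Ω] (P : Measure Ω) {K : ℕ}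
    (r : ℕ → Ω → Fin K → ℝ) (a : ℕ → Ω → Fin K) (T : ℕ) : ℝ :=
  (⨆ i : Fin K, ∫ ω, ∑ t ∈ Finset.range T, r t ω i ∂P) -
    ∫ ω, ∑ t ∈ Finset.range T, r t ω (a t ω) ∂P

theorem keep_nonempty {K : ℕ} (T : ℕ) (r : ℕ → Fin K → ℝ) (d : ℕ → Fin K → ℕ∞)
    (a : ℕ → Fin K) (t : ℕ) {S : Finset (Fin K)} (hS : S.Nonempty) :
    (keep T r d a t S).Nonempty := by
  obtain ⟨i, hi, hmax⟩ := S.exists_max_image (ucb T r d a t) hS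
  refine ⟨i, Finset.mem_filter.2 ⟨hi, ?_⟩⟩
  rintro ⟨j, hj, hlt⟩
  have h1 : lcb T r d a t j ≤ ucb T r d a t j := by
    have : 0 ≤ radius T d a t j := Real.sqrt_nonneg _
    unfold lcb ucb
    linarith
  linarith [hmax j hj]

theorem queue_ne_nil {K : ℕ} [NeZero K] (T : ℕ) {ord : ℕ → Finset (Fin K) → List (Fin K)}
    (hord : IsPullOrder ord) (r : ℕ → Fin K → ℝ) (d : ℕ → Fin K → ℕ∞) (t : ℕ) :
    (seState T ord r d t).active.Nonempty ∧ (seState T ord r d t).queue ≠ [] := by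
  have hne : ∀ n (S : Finset (Fin K)), S.Nonempty → ord n S ≠ [] := by
    intro n S hS h
    have h2 := (hord n S).2
    rw [h] at h2
    simp only [List.toFinset_nil] at h2
    exact hS.ne_empty h2.symm
  induction t with
  | zero => exact ⟨Finset.univ_nonempty, hne _ _ Finset.univ_nonempty⟩
  | succ t ih =>
    simp only [seState, seStep]
    split_ifs with h
    · exact ⟨keep_nonempty _ _ _ _ _ ih.1, hne _ _ (keep_nonempty _ _ _ _ _ ih.1)⟩
    · exact ⟨ih.1, h⟩

end

end DelayedBandit

open DelayedBandit

/-! On a path with valid confidence intervals and enough short delays (`IsGoodPath`), the optimal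
arm is never eliminated. If arm `i` is still active in round `t`, the confidence bounds at the start
of the current pass did not separate it from the optimal arm. These bounds use at least a fraction
`q / 2` of the pulls made `D` rounds earlier, once `D` dominates the quantiles. Hence the pass
number `D` rounds ago is at most of order `log T / Δ_i² * (1/q_i + 1/q_istar)`
(`IsGoodPath.pass_sub_le`). It remains to control the passes that fit into the last `D` rounds.

Separate quantiles (`IsGoodPath.sum_gap_le`): with `σ` active arms, `D` rounds contain about `D / σ`
passes. At the last pull of `i` the optimal arm and all arms pulled at least as often as `i` are
active, so `σ` can be taken as one plus a rank of `i`. Summing `1 / (1 + rank)` gives `log K`.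

Single quantile (`IsGoodPath.sum_gap_le_of_single`): the gap of the arm pulled in round `t` is at
most `φ (t - D)`, where `φ` is a decreasing function of the pass number with values in `[0,1]`.
Either the pass is early, or the gap is at most `2 * (φ (t - D) - φ t)`, which sums to at most `2 *
D`.

Bad paths are handled by exponential supermartingales along the adaptively chosen pulls
(`lintegral_prod_le_one`). For the rewards, the delays of a round are frozen first; here
reward-independence enters. Each deviation event has probability at most `T⁻⁴`, and the union bound
costs regret `5/4 * K`, absorbed into the logarithmic terms. -/

namespace DelayedBandit

/-! ### Deterministic dynamics of the algorithm: passes, pull counts, active arms. -/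

section Path

variable {K : ℕ}

/-- Number of pulls of arm `i` before round `t`. -/
def numPulls (a : ℕ → Fin K) (t : ℕ) (i : Fin K) : ℕ :=
  ((Finset.range t).filter (fun s => a s = i)).card

theorem numPulls_succ (a : ℕ → Fin K) (t : ℕ) (i : Fin K) :
    numPulls a (t + 1) i = numPulls a t i + if a t = i then 1 else 0 := by
  unfold numPulls
  rw [Finset.range_add_one, Finset.filter_insert]
  split_ifs with h
  · rw [Finset.card_insert_of_notMem (by simp)]
  · simp

theorem keep_congr (T : ℕ) {r r' : ℕ → Fin K → ℝ} {d d' : ℕ → Fin K → ℕ∞} {a a' : ℕ → Fin K}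
    {t : ℕ} (hr : ∀ s < t, r s = r' s) (hd : ∀ s < t, d s = d' s) (ha : ∀ s < t, a s = a' s)
    (S : Finset (Fin K)) : keep T r d a t S = keep T r' d' a' t S := by
  have hF : ∀ i, (Finset.range t).filter (fun s => a s = i ∧ (s : ℕ∞) + d s (a s) < (t : ℕ∞)) =
      (Finset.range t).filter (fun s => a' s = i ∧ (s : ℕ∞) + d' s (a' s) < (t : ℕ∞)) := by
    intro i
    refine Finset.filter_congr fun s hs => ?_
    rw [ha s (Finset.mem_range.1 hs), hd s (Finset.mem_range.1 hs)]
  have hn : ∀ i, numObs d a t i = numObs d' a' t i := by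
    intro i
    unfold numObs
    rw [hF i]
  have hm : ∀ i, empMean r d a t i = empMean r' d' a' t i := by
    intro i
    unfold empMean
    rw [hF i, hn i]
    congr 1
    refine Finset.sum_congr rfl fun s hs => ?_
    have hs' := Finset.mem_range.1 (Finset.mem_filter.1 hs).1
    rw [ha s hs', hr s hs']
  have hrad : ∀ i, radius T d a t i = radius T d' a' t i := by
    intro i
    unfold radius
    rw [hn i]
  unfold keep
  refine Finset.filter_congr fun i _ => ?_
  simp only [ucb, lcb, hm, hrad]

variable [NeZero K] {T : ℕ} {ord : ℕ → Finset (Fin K) → List (Fin K)}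

theorem seState_congr {r r' : ℕ → Fin K → ℝ} {d d' : ℕ → Fin K → ℕ∞} {t : ℕ}
    (hr : ∀ s < t, r s = r' s) (hd : ∀ s < t, d s = d' s) :
    seState T ord r d t = seState T ord r' d' t := by
  induction t with
  | zero => rfl
  | succ t ih =>
    have h := ih (fun s hs => hr s (by omega)) (fun s hs => hd s (by omega))
    simp only [seState, seStep, h]
    rw [keep_congr T hr hd (fun _ _ => rfl)]

/-- Non-anticipation: later this makes the pulled arm independent of the rewards and delays of its
own round. -/
theorem seArm_congr {r r' : ℕ → Fin K → ℝ} {d d' : ℕ → Fin K → ℕ∞} {t : ℕ}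
    (hr : ∀ s < t, r s = r' s) (hd : ∀ s < t, d s = d' s) :
    seArm T ord r d t = seArm T ord r' d' t := by
  simp only [seArm, seState_congr hr hd]

variable {r : ℕ → Fin K → ℝ} {d : ℕ → Fin K → ℕ∞}

theorem seState_succ_pulled (t : ℕ) : (seState T ord r d (t + 1)).pulled =
    Function.update (seState T ord r d t).pulled t (seArm T ord r d t) := by
  simp only [seState, seStep, seArm]
  split_ifs <;> rfl

theorem pulled_eq_seArm {t s : ℕ} (hs : s < t) :
    (seState T ord r d t).pulled s = seArm T ord r d s := by
  induction t with
  | zero => omega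
  | succ t ih =>
    rw [seState_succ_pulled]
    by_cases h : s = t
    · subst h; simp
    · rw [Function.update_of_ne h, ih (by omega)]

theorem seState_succ_of_tail_ne {t : ℕ} (h : (seState T ord r d t).queue.tail ≠ []) :
    (seState T ord r d (t + 1)).pass = (seState T ord r d t).pass ∧
    (seState T ord r d (t + 1)).active = (seState T ord r d t).active ∧
    (seState T ord r d (t + 1)).queue = (seState T ord r d t).queue.tail := by
  simp [seState, seStep, h]

theorem seState_succ_of_tail_eq {t : ℕ} (h : (seState T ord r d t).queue.tail = []) :
    (seState T ord r d (t + 1)).pass = (seState T ord r d t).pass + 1 ∧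
    (seState T ord r d (t + 1)).active =
      keep T r d (seArm T ord r d) (t + 1) (seState T ord r d t).active ∧
    (seState T ord r d (t + 1)).queue =
      ord ((seState T ord r d t).pass + 1) (seState T ord r d (t + 1)).active := by
  -- The stored history agrees with the actual pulls before round `t + 1`, and `keep` looks no
  -- further.
  have hk : keep T r d (Function.update (seState T ord r d t).pulled t
        (seState T ord r d t).next) (t + 1) (seState T ord r d t).active =
      keep T r d (seArm T ord r d) (t + 1) (seState T ord r d t).active := by
    refine keep_congr T (fun _ _ => rfl) (fun _ _ => rfl) (fun s hs => ?_) _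
    have := pulled_eq_seArm (T := T) (ord := ord) (r := r) (d := d) hs
    rwa [seState_succ_pulled] at this
  simp only [seState, seStep, h, if_true, hk, and_self]

theorem active_antitone : Antitone fun t => (seState T ord r d t).active := by
  refine antitone_nat_of_succ_le fun t => ?_
  by_cases h : (seState T ord r d t).queue.tail = []
  · rw [(seState_succ_of_tail_eq h).2.1]
    exact Finset.filter_subset _ _
  · rw [(seState_succ_of_tail_ne h).2.1]

theorem pass_monotone : Monotone fun t => (seState T ord r d t).pass := by
  refine monotone_nat_of_le_succ fun t => ?_
  by_cases h : (seState T ord r d t).queue.tail = []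
  · rw [(seState_succ_of_tail_eq h).1]; omega
  · rw [(seState_succ_of_tail_ne h).1]

variable (hord : IsPullOrder ord)

include hord

theorem queue_nodup_subset (t : ℕ) : (seState T ord r d t).queue.Nodup ∧
    (seState T ord r d t).queue ⊆ (seState T ord r d t).active.toList := by
  induction t with
  | zero =>
    refine ⟨(hord _ _).1, fun i _ => ?_⟩
    simp [seState]
  | succ t ih =>
    by_cases h : (seState T ord r d t).queue.tail = []
    · rw [(seState_succ_of_tail_eq h).2.2]
      refine ⟨(hord _ _).1, fun i hi => ?_⟩
      rw [Finset.mem_toList]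
      rw [← List.mem_toFinset, (hord _ _).2] at hi
      exact hi
    · rw [(seState_succ_of_tail_ne h).2.2, (seState_succ_of_tail_ne h).2.1]
      exact ⟨ih.1.tail, fun i hi => ih.2 (List.mem_of_mem_tail hi)⟩

theorem queue_eq_cons (t : ℕ) : (seState T ord r d t).queue =
    seArm T ord r d t :: (seState T ord r d t).queue.tail := by
  have h := (queue_ne_nil T hord r d t).2
  unfold seArm SEState.next
  cases hq : (seState T ord r d t).queue with
  | nil => exact absurd hq h
  | cons b l => simp

theorem seArm_mem_active (t : ℕ) : seArm T ord r d t ∈ (seState T ord r d t).active := by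
  have h := (queue_nodup_subset (T := T) (r := r) (d := d) hord t).2
  rw [← Finset.mem_toList]
  apply h
  rw [queue_eq_cons hord t]
  simp

/-- In each pass the arms that have left the queue were pulled once more than the others. -/
theorem numPulls_eq_pass (t : ℕ) (i : Fin K) :
    (i ∈ (seState T ord r d t).queue →
      numPulls (seArm T ord r d) t i = (seState T ord r d t).pass) ∧
    (i ∈ (seState T ord r d t).active → i ∉ (seState T ord r d t).queue →
      numPulls (seArm T ord r d) t i = (seState T ord r d t).pass + 1) ∧
    (i ∉ (seState T ord r d t).active →
      numPulls (seArm T ord r d) t i ≤ (seState T ord r d t).pass) := by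
  induction t with
  | zero =>
    refine ⟨fun _ => by simp [numPulls, seState], fun _ h => ?_, fun h => ?_⟩
    · exfalso
      apply h
      have h2 := (hord 0 Finset.univ).2
      simp only [seState]
      rw [← List.mem_toFinset, h2]
      simp
    · simp [numPulls]
  | succ t ih =>
    have hq := queue_eq_cons (T := T) (r := r) (d := d) hord t
    have hnd := (queue_nodup_subset (T := T) (r := r) (d := d) hord t).1
    have ha := seArm_mem_active (T := T) (r := r) (d := d) hord t
    rw [numPulls_succ]
    set q := (seState T ord r d t).queue with hqdef
    by_cases h : q.tail = []
    · obtain ⟨h1, h2, h3⟩ := seState_succ_of_tail_eq h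
      have hall : i ∈ (seState T ord r d t).active →
          numPulls (seArm T ord r d) t i + (if seArm T ord r d t = i then 1 else 0) =
            (seState T ord r d t).pass + 1 := by
        intro hi
        split_ifs with hc
        · rw [ih.1 (by rw [hq, hc]; simp)]
        · rw [ih.2.1 hi (by rw [hq, h]; simpa using fun h' => hc h'.symm)]
      have hsub : (seState T ord r d (t + 1)).active ⊆ (seState T ord r d t).active :=
        active_antitone (Nat.le_succ t)
      have hmem : ∀ j, j ∈ (seState T ord r d (t + 1)).queue ↔
          j ∈ (seState T ord r d (t + 1)).active := by
        intro j
        rw [h3, ← List.mem_toFinset, (hord _ _).2]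
      refine ⟨fun hi => ?_, fun hi hi' => absurd ((hmem i).2 hi) hi', fun hi => ?_⟩
      · rw [hall (hsub ((hmem i).1 hi)), h1]
      · rw [h1]
        by_cases hi' : i ∈ (seState T ord r d t).active
        · rw [hall hi']
        · have := ih.2.2 hi'
          have : seArm T ord r d t ≠ i := fun h => hi' (h ▸ ha)
          simp only [this, if_false]
          omega
    · obtain ⟨h1, h2, h3⟩ := seState_succ_of_tail_ne h
      rw [← hqdef] at h3
      rw [h1, h2, h3]
      rw [hq] at hnd
      have hnd' := (List.nodup_cons.1 hnd).1
      refine ⟨fun hi => ?_, fun hi hi' => ?_, fun hi => ?_⟩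
      · have hne : seArm T ord r d t ≠ i := fun h => hnd' (h ▸ hi)
        simp only [hne, if_false]
        exact ih.1 (by rw [hq]; exact List.mem_cons_of_mem _ hi)
      · split_ifs with hc
        · rw [ih.1 (by rw [hq, hc]; simp)]
        · rw [ih.2.1 hi]
          rw [hq, List.mem_cons]
          rintro (h | h)
          · exact hc h.symm
          · exact hi' h
      · have hne : seArm T ord r d t ≠ i := fun h => hi (h ▸ ha)
        simp only [hne, if_false]
        exact ih.2.2 hi

theorem numPulls_of_seArm_eq {t : ℕ} {i : Fin K} (h : seArm T ord r d t = i) :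
    numPulls (seArm T ord r d) t i = (seState T ord r d t).pass := by
  refine (numPulls_eq_pass hord t i).1 ?_
  rw [queue_eq_cons hord t, h]
  simp

theorem pass_le_numPulls {t : ℕ} {i : Fin K} (h : i ∈ (seState T ord r d t).active) :
    (seState T ord r d t).pass ≤ numPulls (seArm T ord r d) t i := by
  by_cases hq : i ∈ (seState T ord r d t).queue
  · rw [(numPulls_eq_pass hord t i).1 hq]
  · rw [(numPulls_eq_pass hord t i).2.1 h hq]; omega

/-- The count of an eliminated arm is frozen. Read contrapositively: an arm whose count ever exceeds
the pass number of round `t` is still active in round `t`. -/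
theorem numPulls_of_notMem_active {t u : ℕ} {i : Fin K}
    (h : i ∉ (seState T ord r d t).active) (hu : t ≤ u) :
    numPulls (seArm T ord r d) u i ≤ (seState T ord r d t).pass := by
  induction u, hu using Nat.le_induction with
  | base => exact (numPulls_eq_pass hord t i).2.2 h
  | succ u hu ih =>
    rw [numPulls_succ]
    have hne : seArm T ord r d u ≠ i := fun h' =>
      h (active_antitone hu (h' ▸ seArm_mem_active hord u))
    simpa [hne] using ih

/-- A pass that starts at a time when at least `σ` arms remain active takes at least `σ` rounds. -/
theorem pass_progress {σ u t : ℕ} (hut : u ≤ t) (hσ : σ ≤ (seState T ord r d t).active.card) :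
    ((seState T ord r d t).pass + 1) * σ + min σ (seState T ord r d u).queue.length ≤
      ((seState T ord r d u).pass + 1) * σ + min σ (seState T ord r d t).queue.length +
        (t - u) := by
  -- The potential `(pass + 1) * σ - min σ (queue length)` grows by at most one per round, also when
  -- a new pass refills the queue with at least `σ` arms.
  induction t, hut using Nat.le_induction with
  | base => omega
  | succ t hut ih =>
    have hσ' : σ ≤ (seState T ord r d t).active.card :=
      hσ.trans (Finset.card_le_card (active_antitone (Nat.le_succ t)))
    have ih := ih hσ'
    have hq := congrArg List.length (queue_eq_cons (T := T) (r := r) (d := d) hord t)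
    rw [List.length_cons] at hq
    by_cases h : (seState T ord r d t).queue.tail = []
    · obtain ⟨h1, h2, h3⟩ := seState_succ_of_tail_eq h
      have hl : (seState T ord r d (t + 1)).queue.length =
          (seState T ord r d (t + 1)).active.card := by
        rw [h3, ← List.toFinset_card_of_nodup (hord _ _).1, (hord _ _).2]
      rw [h, List.length_nil] at hq
      rw [hl, h1, min_eq_left hσ]
      rw [add_mul _ 1 σ, one_mul]
      have : min σ (seState T ord r d t).queue.length ≤ 1 := by omega
      omega
    · obtain ⟨h1, h2, h3⟩ := seState_succ_of_tail_ne h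
      rw [h1, h3]
      omega

theorem pass_mul_lt {σ u t : ℕ} (hut : u ≤ t) (hσ : σ ≤ (seState T ord r d t).active.card)
    (hσ0 : 0 < σ) : (seState T ord r d t).pass * σ <
      ((seState T ord r d u).pass + 1) * σ + (t - u) := by
  have h := pass_progress hord hut hσ
  have hq := List.length_pos_iff.2 (queue_ne_nil T hord r d u).2
  rw [add_mul _ 1 σ, one_mul] at h
  omega

/-- Here `t₀` is the first round of the current pass, the last time at which confidence bounds were
compared; no comparison precedes the very first pass. -/
theorem pass_start (t : ℕ) : ∃ t₀ ≤ t,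
    (seState T ord r d t₀).active = (seState T ord r d t).active ∧
    t - t₀ + (seState T ord r d t).queue.length = (seState T ord r d t).active.card ∧
    (t₀ = 0 ∨ ∀ i ∈ (seState T ord r d t).active, ∀ j ∈ (seState T ord r d t).active,
      ¬ ucb T r d (seArm T ord r d) t₀ i < lcb T r d (seArm T ord r d) t₀ j) := by
  have hlen : ∀ n S, (ord n S).length = S.card := fun n S => by
    rw [← List.toFinset_card_of_nodup (hord _ _).1, (hord _ _).2]
  induction t with
  | zero => exact ⟨0, le_rfl, rfl, by simp [seState, hlen], Or.inl rfl⟩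
  | succ t ih =>
    by_cases h : (seState T ord r d t).queue.tail = []
    · obtain ⟨h1, h2, h3⟩ := seState_succ_of_tail_eq h
      refine ⟨t + 1, le_rfl, rfl, by rw [h3, hlen]; simp, Or.inr fun i hi j hj hlt => ?_⟩
      rw [h2] at hi hj
      exact (Finset.mem_filter.1 hi).2 ⟨j, (Finset.mem_filter.1 hj).1, hlt⟩
    · obtain ⟨h1, h2, h3⟩ := seState_succ_of_tail_ne h
      obtain ⟨t₀, ht, ha, hc, hu⟩ := ih
      have hq := congrArg List.length (queue_eq_cons (T := T) (r := r) (d := d) hord t)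
      rw [List.length_cons] at hq
      refine ⟨t₀, by omega, by rw [ha, h2], by rw [h2, h3]; omega, by rwa [h2]⟩

end Path

/-! ### Regret on good paths, with one quantile per arm. -/

section Good

variable {K : ℕ}

/-- Feedback of a pull made before `t - D` with delay at most `γ ≤ D` has arrived before `t`. For `t
≤ D` the truncated range is empty. -/
theorem card_le_numObs {d : ℕ → Fin K → ℕ∞} {a : ℕ → Fin K} {i : Fin K} {γ D t : ℕ} (hD : γ ≤ D) :
    ((Finset.range (t - D)).filter (fun s => a s = i ∧ d s i ≤ (γ : ℕ∞))).card ≤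
      numObs d a t i := by
  refine Finset.card_le_card fun s hs => ?_
  simp only [Finset.mem_filter, Finset.mem_range] at hs ⊢
  obtain ⟨h1, h2, h3⟩ := hs
  refine ⟨by omega, h2, ?_⟩
  rw [h2]
  calc (s : ℕ∞) + d s i ≤ (s : ℕ∞) + (γ : ℕ∞) := by gcongr
    _ = ((s + γ : ℕ) : ℕ∞) := by push_cast; rfl
    _ < (t : ℕ∞) := by exact_mod_cast (by omega : s + γ < t)

theorem radius_le {d : ℕ → Fin K → ℕ∞} {a : ℕ → Fin K} {i : Fin K} {T t : ℕ} {q k : ℝ}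
    (hT : 2 ≤ T) (hq : 0 < q) (hk : 0 < k) (h : q * k / 2 ≤ numObs d a t i) :
    radius T d a t i ≤ 2 * Real.sqrt (Real.log T / (q * k)) := by
  have hL : 0 < Real.log T := Real.log_pos (by exact_mod_cast hT)
  have h2 : (2 : ℝ) = Real.sqrt 4 := by
    rw [show (4 : ℝ) = 2 ^ 2 by norm_num, Real.sqrt_sq (by norm_num)]
  rw [h2, ← Real.sqrt_mul (by norm_num)]
  unfold radius
  refine Real.sqrt_le_sqrt ?_
  have hm : q * k / 2 ≤ ((max (numObs d a t i) 1 : ℕ) : ℝ) :=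
    h.trans (by exact_mod_cast le_max_left _ _)
  have hqk : 0 < q * k := mul_pos hq hk
  calc 2 * Real.log T / ((max (numObs d a t i) 1 : ℕ) : ℝ)
      ≤ 2 * Real.log T / (q * k / 2) := by gcongr
    _ = 4 * (Real.log T / (q * k)) := by field_simp; norm_num

theorem sum_gap_eq (T : ℕ) {istar : Fin K} (a : ℕ → Fin K) (Δ : Fin K → ℝ) (hs : Δ istar = 0) :
    ∑ t ∈ Finset.range T, Δ (a t) = ∑ i ∈ Finset.univ.erase istar, numPulls a T i * Δ i := by
  rw [Finset.sum_erase _ (by rw [hs, mul_zero]),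
    ← Finset.sum_fiberwise (Finset.range T) a]
  refine Finset.sum_congr rfl fun i _ => ?_
  rw [Finset.sum_congr rfl fun t ht => by rw [(Finset.mem_filter.1 ht).2], Finset.sum_const,
    nsmul_eq_mul]
  rfl

variable [NeZero K]

/-- A realization on which the empirical means lie within their confidence radii and a fraction
`q i / 2` of the pulls of each arm `i` have delay at most `γ i`, once there are enough of them. -/
structure IsGoodPath (T : ℕ) (ord : ℕ → Finset (Fin K) → List (Fin K)) (r : ℕ → Fin K → ℝ)
    (d : ℕ → Fin K → ℕ∞) (μ q : Fin K → ℝ) (γ : Fin K → ℕ) : Prop where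
  mean : ∀ t < T, ∀ i, |empMean r d (seArm T ord r d) t i - μ i| ≤
    radius T d (seArm T ord r d) t i
  delay : ∀ t < T, ∀ i, 32 * Real.log T ≤ q i * numPulls (seArm T ord r d) t i →
    q i * numPulls (seArm T ord r d) t i / 2 ≤
      (((Finset.range t).filter
        (fun s => seArm T ord r d s = i ∧ d s i ≤ (γ i : ℕ∞))).card : ℝ)

variable {T : ℕ} {ord : ℕ → Finset (Fin K) → List (Fin K)} {r : ℕ → Fin K → ℝ}
  {d : ℕ → Fin K → ℕ∞} {μ q : Fin K → ℝ} {γ : Fin K → ℕ} {istar : Fin K}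

theorem IsGoodPath.istar_mem_active (h : IsGoodPath T ord r d μ q γ)
    (hstar : ∀ i, μ i ≤ μ istar) {t : ℕ} (ht : t < T) :
    istar ∈ (seState T ord r d t).active := by
  induction t with
  | zero => simp [seState]
  | succ t ih =>
    have ih := ih (by omega)
    by_cases hq : (seState T ord r d t).queue.tail = []
    · rw [(seState_succ_of_tail_eq hq).2.1]
      refine Finset.mem_filter.2 ⟨ih, ?_⟩
      rintro ⟨j, -, hlt⟩
      have h1 := abs_le.1 (h.mean (t + 1) ht j)
      have h2 := abs_le.1 (h.mean (t + 1) ht istar)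
      unfold ucb lcb at hlt
      linarith [hstar j]
    · rwa [(seState_succ_of_tail_ne hq).2.1]

/-- On a good path, an arm that is active in round `t` was in an early pass `D` rounds before. -/
theorem IsGoodPath.pass_sub_le (h : IsGoodPath T ord r d μ q γ) (hord : IsPullOrder ord)
    (hT : 2 ≤ T) (hstar : ∀ i, μ i ≤ μ istar) (hq : ∀ i, 0 < q i) {i : Fin K}
    (hΔ : 0 < μ istar - μ i) (hΔ1 : μ istar - μ i ≤ 1) {D t : ℕ} (hi : γ i ≤ D)
    (hs : γ istar ≤ D) (ht : t < T) (hact : i ∈ (seState T ord r d t).active) :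
    ((seState T ord r d (t - D)).pass : ℝ) ≤
      32 * Real.log T / (μ istar - μ i) ^ 2 * (1 / q i + 1 / q istar) + 1 := by
  have hL : 0 < Real.log T := Real.log_pos (by exact_mod_cast hT)
  obtain ⟨t₀, ht₀, ha, hc, hu⟩ := pass_start (T := T) (r := r) (d := d) hord t
  set Δ := μ istar - μ i with hΔdef
  have hqi := hq i
  have hqs := hq istar
  have hcl : 0 < (seState T ord r d t).queue.length :=
    List.length_pos_iff.2 (queue_ne_nil T hord r d t).2
  have hσ : (seState T ord r d t).active.card ≤ (seState T ord r d (t - D)).active.card :=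
    Finset.card_le_card (active_antitone (Nat.sub_le t D))
  have hσ0 : 0 < (seState T ord r d t).active.card := by omega
  have hp := pass_mul_lt (T := T) (r := r) (d := d) hord (Nat.sub_le_sub_right ht₀ D) hσ hσ0
  -- Fewer than `active.card` rounds separate `t₀` from `t`, so shifting both back by `D` the pass
  -- number advances at most once.
  have hle : (seState T ord r d (t - D)).pass ≤ (seState T ord r d (t₀ - D)).pass + 1 := by
    have : (seState T ord r d (t - D)).pass * (seState T ord r d t).active.card <
        ((seState T ord r d (t₀ - D)).pass + 2) * (seState T ord r d t).active.card := by
      rw [add_mul] at hp ⊢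
      omega
    have := lt_of_mul_lt_mul_right this (Nat.zero_le _)
    omega
  have hle' : ((seState T ord r d (t - D)).pass : ℝ) ≤ (seState T ord r d (t₀ - D)).pass + 1 := by
    exact_mod_cast hle
  refine hle'.trans (add_le_add_left ?_ 1)
  set k := (seState T ord r d (t₀ - D)).pass with hk
  by_contra! hlt
  have hx0 : 0 < 32 * Real.log T / Δ ^ 2 * (1 / q i + 1 / q istar) := by positivity
  have hk0 : (0 : ℝ) < k := hx0.trans hlt
  have hΔsq : Δ ^ 2 ≤ 1 := by nlinarith
  have hdiv : 32 * Real.log T ≤ 32 * Real.log T / Δ ^ 2 := by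
    rw [le_div_iff₀ (by positivity)]
    nlinarith
  -- If `t₀ = 0`, then `k` is the initial pass number `0`, contradicting `0 < k`.
  have hu' := hu.resolve_left (by
    rintro rfl
    simp [hk, seState] at hk0)
  have hsact := h.istar_mem_active hstar ht
  have hobs : ∀ j, 0 < q j → γ j ≤ D → j ∈ (seState T ord r d t).active →
      1 / q j ≤ 1 / q i + 1 / q istar →
      radius T d (seArm T ord r d) t₀ j ≤ 2 * Real.sqrt (Real.log T / (q j * k)) := by
    intro j hqj hγ hj hle
    refine radius_le hT hqj hk0 ?_
    have hj' : j ∈ (seState T ord r d (t₀ - D)).active :=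
      active_antitone ((Nat.sub_le t₀ D).trans ht₀) hj
    have hm : (k : ℝ) ≤ numPulls (seArm T ord r d) (t₀ - D) j := by
      exact_mod_cast pass_le_numPulls hord hj'
    -- Since `Δ ≤ 1`, a large `k` also passes the threshold in `IsGoodPath.delay`.
    have hbig : 32 * Real.log T ≤ q j * k := by
      have : 32 * Real.log T * (1 / q j) ≤ k :=
        (mul_le_mul hdiv hle (by positivity) (by positivity)).trans hlt.le
      rw [mul_one_div, div_le_iff₀ hqj] at this
      linarith
    have hd := h.delay (t₀ - D) (by omega) j (hbig.trans (by gcongr))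
    calc q j * k / 2 ≤ q j * numPulls (seArm T ord r d) (t₀ - D) j / 2 := by gcongr
      _ ≤ _ := hd
      _ ≤ _ := by exact_mod_cast card_le_numObs hγ
  have h1 := hobs i hqi hi hact (le_add_of_nonneg_right (by positivity))
  have h2 := hobs istar hqs hs hsact (le_add_of_nonneg_left (by positivity))
  have hnot := hu' i hact istar hsact
  have h3 := abs_le.1 (h.mean t₀ (by omega) i)
  have h4 := abs_le.1 (h.mean t₀ (by omega) istar)
  unfold ucb lcb at hnot
  set A := Real.sqrt (Real.log T / (q i * k)) with hA
  set B := Real.sqrt (Real.log T / (q istar * k)) with hB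
  have hA2 : A ^ 2 = Real.log T / (q i * k) := Real.sq_sqrt (by positivity)
  have hB2 : B ^ 2 = Real.log T / (q istar * k) := Real.sq_sqrt (by positivity)
  -- Overlap of the intervals gives `Δ ≤ 2 * (radius i + radius istar)`, and the radii are at most
  -- `2 * A` and `2 * B`. Squaring with `(A + B)² ≤ 2 * (A² + B²)` produces the constant 32.
  have hΔAB : Δ ≤ 4 * (A + B) := by
    rw [hΔdef]; linarith
  have hA0 : 0 ≤ A := Real.sqrt_nonneg _
  have hB0 : 0 ≤ B := Real.sqrt_nonneg _
  have hfin : Δ ^ 2 ≤ 32 * (A ^ 2 + B ^ 2) := by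
    nlinarith [sq_nonneg (A - B), pow_le_pow_left₀ hΔ.le hΔAB 2]
  rw [hA2, hB2] at hfin
  have : 32 * Real.log T / Δ ^ 2 * (1 / q i + 1 / q istar) =
      32 * (Real.log T / (q i * k) + Real.log T / (q istar * k)) * k / Δ ^ 2 := by
    field_simp
  rw [this, div_lt_iff₀ (by positivity)] at hlt
  nlinarith

/-- The minimizer of `f` is counted against all of `s`; erasing it only shrinks the other counts, so
induction applies. Each count includes the element itself, hence the denominators start at 2, and
ties only help. -/
theorem sum_inv_rank_le {ι : Type*} [DecidableEq ι] (f : ι → ℕ) (s : Finset ι) :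
    ∑ i ∈ s, (1 : ℝ) / (1 + (s.filter (fun j => f i ≤ f j)).card) ≤
      ∑ k ∈ Finset.range s.card, (1 : ℝ) / (k + 2) := by
  induction hn : s.card generalizing s with
  | zero => simp [Finset.card_eq_zero.1 hn]
  | succ n ih =>
    have hne : s.Nonempty := Finset.card_pos.1 (by omega)
    obtain ⟨i₀, hi₀, hmin⟩ := s.exists_min_image f hne
    rw [← Finset.add_sum_erase s _ hi₀, Finset.sum_range_succ, add_comm]
    have hc : (s.erase i₀).card = n := by rw [Finset.card_erase_of_mem hi₀, hn]; rfl
    refine add_le_add ((Finset.sum_le_sum fun i hi => ?_).trans (ih (s.erase i₀) hc)) ?_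
    · refine one_div_le_one_div_of_le (by positivity) (add_le_add_right ?_ 1)
      exact_mod_cast Finset.card_le_card
        (Finset.filter_subset_filter _ (Finset.erase_subset i₀ s))
    · rw [Finset.filter_true_of_mem hmin, hn]
      push_cast
      exact le_of_eq (by ring)

/-- Each step uses `log ((m + 2) / (m + 1)) ≥ 1 / (m + 2)`. As the sum starts at `1/2`, the bound is
`log n` without an additive constant. -/
theorem sum_one_div_le_log {n : ℕ} (hn : 1 ≤ n) :
    ∑ k ∈ Finset.range (n - 1), (1 : ℝ) / (k + 2) ≤ Real.log n := by
  induction n, hn using Nat.le_induction with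
  | base => simp
  | succ n hn ih =>
    obtain ⟨m, rfl⟩ : ∃ m, n = m + 1 := ⟨n - 1, by omega⟩
    simp only [Nat.add_sub_cancel] at ih ⊢
    rw [Finset.sum_range_succ]
    have h0 : (0 : ℝ) < m + 1 := by positivity
    have h1 : 1 - ((m : ℝ) + 2)⁻¹ * ((m : ℝ) + 1) = 1 / (m + 2) := by field_simp; ring
    have h2 := Real.one_sub_inv_le_log_of_pos (x := ((m : ℝ) + 2) / (m + 1)) (by positivity)
    rw [Real.log_div (by positivity) (by positivity), inv_div, div_eq_inv_mul, h1] at h2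
    push_cast at ih ⊢
    rw [show (m : ℝ) + 1 + 1 = m + 2 by ring]
    linarith

/-- Number of pulls of a suboptimal arm on a good path; the window of `D` rounds, in which feedback
is awaited, is shared with the arms that are pulled at least as often. -/
theorem IsGoodPath.numPulls_le (h : IsGoodPath T ord r d μ q γ) (hord : IsPullOrder ord)
    (hT : 2 ≤ T) (hstar : ∀ i, μ i ≤ μ istar) (hq : ∀ i, 0 < q i) {i : Fin K}
    (hΔ : 0 < μ istar - μ i) (hΔ1 : μ istar - μ i ≤ 1) :
    (numPulls (seArm T ord r d) T i : ℝ) ≤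
      32 * Real.log T / (μ istar - μ i) ^ 2 * (1 / q i + 1 / q istar) + 3 +
        (γ i + γ istar : ℕ) * (1 / (1 + (((Finset.univ.erase istar).filter (fun j =>
          numPulls (seArm T ord r d) T i ≤ numPulls (seArm T ord r d) T j)).card : ℝ))) := by
  have hL : 0 < Real.log T := Real.log_pos (by exact_mod_cast hT)
  have hqi := hq i
  have hqs := hq istar
  set a := seArm T ord r d with ha
  rcases Nat.eq_zero_or_pos (numPulls a T i) with h0 | hpos
  · rw [h0, Nat.cast_zero]; positivity
  · obtain ⟨l, hl, hmax⟩ := Finset.exists_max_image _ id (Finset.card_pos.1 hpos)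
    simp only [Finset.mem_filter, Finset.mem_range, id] at hl hmax
    obtain ⟨hlT, hal⟩ := hl
    have hlast : numPulls a T i = (seState T ord r d l).pass + 1 := by
      rw [← numPulls_of_seArm_eq hord hal]
      have h1 : numPulls a (l + 1) i = numPulls a l i + 1 := by rw [numPulls_succ, if_pos hal]
      rw [← ha, ← h1]
      unfold numPulls
      congr 1
      ext s
      simp only [Finset.mem_filter, Finset.mem_range]
      constructor
      · rintro ⟨h2, h3⟩
        exact ⟨Nat.lt_succ_of_le (hmax s ⟨h2, h3⟩), h3⟩
      · rintro ⟨h2, h3⟩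
        exact ⟨by omega, h3⟩
    set σ := 1 + ((Finset.univ.erase istar).filter (fun j =>
          numPulls a T i ≤ numPulls a T j)).card with hσ
    -- An arm pulled at least `pass + 1` times in total cannot have been eliminated by round `l`;
    -- the summand 1 in `σ` is the optimal arm.
    have hσcard : σ ≤ (seState T ord r d l).active.card := by
      rw [hσ, add_comm, ← Finset.card_insert_of_notMem (a := istar) (by simp)]
      refine Finset.card_le_card fun j hj => ?_
      rcases Finset.mem_insert.1 hj with rfl | hj
      · exact h.istar_mem_active hstar hlT
      · by_contra hc
        have := numPulls_of_notMem_active hord hc hlT.le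
        have := (Finset.mem_filter.1 hj).2
        rw [← ha] at *
        omega
    have hprog := pass_mul_lt (T := T) (r := r) (d := d) hord (Nat.sub_le l (γ i + γ istar))
      hσcard (by omega)
    have hact : i ∈ (seState T ord r d l).active := by
      have := seArm_mem_active (T := T) (r := r) (d := d) hord l
      rwa [← ha, hal] at this
    have hkey := h.pass_sub_le hord hT hstar hq hΔ hΔ1 (D := γ i + γ istar) (by omega) (by omega)
      hlT hact
    have hσ0 : (0 : ℝ) < (σ : ℝ) := by exact_mod_cast (by omega : 0 < σ)
    have hprog' : ((seState T ord r d l).pass : ℝ) * σ ≤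
        ((seState T ord r d (l - (γ i + γ istar))).pass + 1) * σ + (γ i + γ istar : ℕ) := by
      exact_mod_cast (by omega)
    have hdiv : ((seState T ord r d l).pass : ℝ) ≤
        (seState T ord r d (l - (γ i + γ istar))).pass + 1 + (γ i + γ istar : ℕ) * (1 / σ) := by
      rw [mul_one_div, ← sub_le_iff_le_add', le_div_iff₀ hσ0]
      linarith
    have hcast : (1 : ℝ) + (((Finset.univ.erase istar).filter (fun j =>
          numPulls a T i ≤ numPulls a T j)).card : ℝ) = σ := by rw [hσ]; push_cast; rfl
    -- The constant 3 is one pass from `pass_sub_le`, one incomplete pass in the window, and the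
    -- last pull itself.
    rw [hcast, hlast]
    push_cast at hdiv ⊢
    linarith

theorem IsGoodPath.sum_gap_le (h : IsGoodPath T ord r d μ q γ) (hord : IsPullOrder ord)
    (hT : 2 ≤ T) (hstar : ∀ i, μ i ≤ μ istar) (hq : ∀ i, 0 < q i)
    (hΔ : ∀ i ≠ istar, 0 < μ istar - μ i) (hΔ1 : ∀ i, μ istar - μ i ≤ 1) {B : ℝ} (hB0 : 0 ≤ B)
    (hB : ∀ i ≠ istar, (γ i + γ istar : ℕ) * (μ istar - μ i) ≤ B) :
    ∑ t ∈ Finset.range T, (μ istar - μ (seArm T ord r d t)) ≤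
      ∑ i ∈ Finset.univ.erase istar,
        (32 * Real.log T / (μ istar - μ i) * (1 / q i + 1 / q istar) + 3) +
      Real.log K * B := by
  set a := seArm T ord r d with ha
  rw [sum_gap_eq T (istar := istar) a (fun i => μ istar - μ i) (by simp)]
  have hstep : ∀ i ∈ Finset.univ.erase istar, (numPulls a T i : ℝ) * (μ istar - μ i) ≤
      (32 * Real.log T / (μ istar - μ i) * (1 / q i + 1 / q istar) + 3) +
      (1 / (1 + (((Finset.univ.erase istar).filter (fun j =>
          numPulls a T i ≤ numPulls a T j)).card : ℝ))) * B := by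
    intro i hi
    have hne := Finset.ne_of_mem_erase hi
    have h1 := h.numPulls_le hord hT hstar hq (hΔ i hne) (hΔ1 i)
    have hp := hΔ i hne
    have h2 := mul_le_mul_of_nonneg_right h1 hp.le
    rw [← ha] at h2
    refine h2.trans ?_
    rw [add_mul, add_mul]
    refine add_le_add (add_le_add (le_of_eq ?_) (by nlinarith [hΔ1 i])) ?_
    · field_simp
    · rw [mul_right_comm, mul_comm]
      exact mul_le_mul_of_nonneg_left (hB i hne) (by positivity)
  refine (Finset.sum_le_sum hstep).trans ?_
  rw [Finset.sum_add_distrib, ← Finset.sum_mul]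
  gcongr
  refine (sum_inv_rank_le (numPulls a T) (Finset.univ.erase istar)).trans ?_
  have : (Finset.univ.erase istar).card = K - 1 := by simp
  rw [this]
  exact sum_one_div_le_log (Nat.one_le_iff_ne_zero.2 (NeZero.ne K))

/-! ### Regret on good paths, with a single quantile. -/

theorem sum_sub_shift_le {φ : ℕ → ℝ} (h0 : ∀ n, 0 ≤ φ n) (h1 : ∀ n, φ n ≤ 1) (D T : ℕ) :
    ∑ t ∈ Finset.range T, (φ (t - D) - φ t) ≤ D := by
  induction D with
  | zero => simp
  | succ D ih =>
    -- A unit shift telescopes to `φ 0` minus the last value; truncated subtraction makes the terms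
    -- with `t ≤ D` vanish.
    have hstep : ∀ T, ∑ t ∈ Finset.range T, (φ (t - (D + 1)) - φ (t - D)) ≤
        1 - φ (T - (D + 1)) := by
      intro T
      induction T with
      | zero => simp [h1]
      | succ T ih =>
        rw [Finset.sum_range_succ, show T + 1 - (D + 1) = T - D by omega]
        linarith
    have : ∑ t ∈ Finset.range T, (φ (t - (D + 1)) - φ t) =
        ∑ t ∈ Finset.range T, (φ (t - (D + 1)) - φ (t - D)) +
        ∑ t ∈ Finset.range T, (φ (t - D) - φ t) := by
      rw [← Finset.sum_add_distrib]
      exact Finset.sum_congr rfl fun t _ => by ring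
    rw [this]
    push_cast
    linarith [hstep T, h0 (T - (D + 1))]

/-- An arm is pulled at most once per pass; the `+ 1` accounts for pass number 0. -/
theorem card_pass_le (hord : IsPullOrder ord) (i : Fin K) {y : ℝ} (hy : 0 ≤ y) :
    (((Finset.range T).filter (fun t => seArm T ord r d t = i ∧
      ((seState T ord r d t).pass : ℝ) ≤ y)).card : ℝ) ≤ y + 1 := by
  have hinj : Set.InjOn (fun t => (seState T ord r d t).pass) ((Finset.range T).filter
      (fun t => seArm T ord r d t = i ∧ ((seState T ord r d t).pass : ℝ) ≤ y)) := by
    have key : ∀ s t, s < t → seArm T ord r d s = i → seArm T ord r d t = i →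
        (seState T ord r d s).pass ≠ (seState T ord r d t).pass := by
      intro s t hst hs ht
      rw [← numPulls_of_seArm_eq hord hs, ← numPulls_of_seArm_eq hord ht]
      have h1 := numPulls_succ (seArm T ord r d) s i
      rw [if_pos hs] at h1
      have h2 : numPulls (seArm T ord r d) (s + 1) i ≤ numPulls (seArm T ord r d) t i :=
        Finset.card_le_card (Finset.filter_subset_filter _ (by
          rw [Finset.range_subset_range]; exact hst))
      omega
    intro s hs t ht hst
    simp only [Finset.coe_filter, Set.mem_ofPred_eq] at hs ht
    rcases lt_trichotomy s t with hlt | heq | hlt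
    · exact absurd hst (key s t hlt hs.2.1 ht.2.1)
    · exact heq
    · exact absurd hst.symm (key t s hlt ht.2.1 hs.2.1)
  have hle := Finset.card_le_card_of_injOn (t := Finset.range (⌊y⌋₊ + 1)) _ (fun t ht => by
    simp only [Finset.coe_filter, Set.mem_ofPred_eq, Finset.coe_range, Set.mem_Iio] at ht ⊢
    exact Nat.lt_succ_of_le (Nat.le_floor ht.2.2)) hinj
  rw [Finset.card_range] at hle
  calc _ ≤ ((⌊y⌋₊ + 1 : ℕ) : ℝ) := by exact_mod_cast hle
    _ ≤ y + 1 := by push_cast; linarith [Nat.floor_le hy]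

/-- Upper bound for the gap of an arm that is not yet eliminated after `p` passes. -/
noncomputable def gapBound (c : ℝ) (p : ℕ) : ℝ := 1 / max 1 (Real.sqrt (((p : ℝ) - 1) / c))

theorem gapBound_nonneg (c : ℝ) (p : ℕ) : 0 ≤ gapBound c p := by
  unfold gapBound; positivity

theorem gapBound_le_one (c : ℝ) (p : ℕ) : gapBound c p ≤ 1 := by
  unfold gapBound
  exact div_le_one_of_le₀ (le_max_left _ _) (by positivity)

theorem gapBound_antitone {c : ℝ} (hc : 0 < c) : Antitone (gapBound c) := by
  intro p p' h
  unfold gapBound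
  refine one_div_le_one_div_of_le (by positivity) (max_le_max le_rfl (Real.sqrt_le_sqrt ?_))
  gcongr

/-- `gapBound` solves `p = c / Δ² + 1` for `Δ`, capped at 1; the cap also covers `p ≤ 1`, where the
square root is 0. -/
theorem le_gapBound {c Δ : ℝ} {p : ℕ} (hc : 0 < c) (hΔ : 0 < Δ) (hΔ1 : Δ ≤ 1)
    (hp : (p : ℝ) ≤ c / Δ ^ 2 + 1) : Δ ≤ gapBound c p := by
  unfold gapBound
  rw [le_div_iff₀ (by positivity), mul_max_of_nonneg _ _ hΔ.le, mul_one]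
  refine max_le hΔ1 ?_
  rw [← le_div_iff₀' hΔ]
  refine Real.sqrt_le_iff.2 ⟨by positivity, ?_⟩
  rw [div_le_iff₀ hc, div_pow, one_pow, one_div_mul_eq_div]
  linarith

/-- Four times as many passes halve the gap bound. This makes the drop from `φ (t - D)` to `φ t` at
least `Δ / 2`. -/
theorem gapBound_le {c Δ : ℝ} {p : ℕ} (hc : 0 < c) (hΔ : 0 < Δ)
    (hp : 4 * (c / Δ ^ 2) + 1 ≤ p) : gapBound c p ≤ Δ / 2 := by
  unfold gapBound
  have : 2 / Δ ≤ Real.sqrt (((p : ℝ) - 1) / c) := by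
    refine Real.le_sqrt_of_sq_le ?_
    rw [le_div_iff₀ hc, div_pow]
    calc 2 ^ 2 / Δ ^ 2 * c = 4 * (c / Δ ^ 2) := by ring
      _ ≤ _ := by linarith
  calc 1 / max 1 (Real.sqrt (((p : ℝ) - 1) / c)) ≤ 1 / (2 / Δ) :=
        one_div_le_one_div_of_le (by positivity) (this.trans (le_max_right _ _))
    _ = Δ / 2 := by rw [one_div_div]

theorem IsGoodPath.sum_gap_le_of_single {q₀ : ℝ} {D : ℕ}
    (h : IsGoodPath T ord r d μ (fun _ => q₀) γ)
    (hord : IsPullOrder ord) (hT : 2 ≤ T) (hstar : ∀ i, μ i ≤ μ istar) (hq : 0 < q₀)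
    (hΔ : ∀ i ≠ istar, 0 < μ istar - μ i) (hΔ1 : ∀ i, μ istar - μ i ≤ 1) (hD : ∀ i, γ i ≤ D) :
    ∑ t ∈ Finset.range T, (μ istar - μ (seArm T ord r d t)) ≤
      ∑ i ∈ Finset.univ.erase istar,
        (256 * Real.log T / (q₀ * (μ istar - μ i)) + 2) + 2 * D := by
  classical
  have hL : 0 < Real.log T := Real.log_pos (by exact_mod_cast hT)
  set c := 64 * Real.log T / q₀ with hc
  have hc0 : 0 < c := by positivity
  set a := seArm T ord r d with ha
  set p : ℕ → ℕ := fun t => (seState T ord r d t).pass with hp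
  set φ : ℕ → ℝ := fun t => gapBound c (p t) with hφ
  set Δ : Fin K → ℝ := fun i => μ istar - μ i with hΔdef
  have hanti : Antitone φ := (gapBound_antitone hc0).comp_monotone pass_monotone
  -- In a late pass, `Δ ≤ φ (t - D)` and `φ t ≤ Δ / 2` give `Δ ≤ 2 * (φ (t - D) - φ t)`; in an early
  -- one the gap is paid in full.
  have hround : ∀ t ∈ Finset.range T, Δ (a t) ≤
      (if (p t : ℝ) ≤ 4 * (c / Δ (a t) ^ 2) + 1 then Δ (a t) else 0) +
        2 * (φ (t - D) - φ t) := by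
    intro t ht
    have hφt : φ t ≤ φ (t - D) := hanti (Nat.sub_le t D)
    split_ifs with hsmall
    · linarith
    · by_cases hs : a t = istar
      · rw [hs]
        have : Δ istar = 0 := sub_self _
        linarith
      · have hpos := hΔ _ hs
        have h1 := h.pass_sub_le hord hT hstar (fun _ => hq) hpos (hΔ1 (a t)) (hD _) (hD _)
          (Finset.mem_range.1 ht) (seArm_mem_active hord t)
        change _ ≤ 32 * Real.log T / Δ (a t) ^ 2 * (1 / q₀ + 1 / q₀) + 1 at h1
        have h2 : Δ (a t) ≤ φ (t - D) := by
          refine le_gapBound hc0 hpos (hΔ1 _) (h1.trans (le_of_eq ?_))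
          congr 1
          rw [hc]
          field_simp
          norm_num
        have h3 : φ t ≤ Δ (a t) / 2 := gapBound_le hc0 hpos (not_le.1 hsmall).le
        linarith
  refine (Finset.sum_le_sum hround).trans ?_
  rw [Finset.sum_add_distrib, ← Finset.mul_sum]
  refine add_le_add ?_ (by
    have := sum_sub_shift_le (fun t => gapBound_nonneg c (p t)) (fun t => gapBound_le_one c (p t))
      D T
    simp only [hφ]
    linarith)
  rw [← Finset.sum_fiberwise (Finset.range T) a]
  have hinner : ∀ i, ∑ t ∈ (Finset.range T).filter (fun t => a t = i),
      (if (p t : ℝ) ≤ 4 * (c / Δ (a t) ^ 2) + 1 then Δ (a t) else 0) =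
      (((Finset.range T).filter (fun t => a t = i ∧
        (p t : ℝ) ≤ 4 * (c / Δ i ^ 2) + 1)).card : ℝ) * Δ i := by
    intro i
    rw [← Finset.filter_filter, ← nsmul_eq_mul, ← Finset.sum_const, Finset.sum_filter (s :=
      (Finset.range T).filter (fun t => a t = i))]
    refine Finset.sum_congr rfl fun t ht => ?_
    rw [(Finset.mem_filter.1 ht).2]
  simp only [hinner]
  rw [← Finset.sum_erase (a := istar) _ (by
    have : Δ istar = 0 := sub_self _
    rw [this, mul_zero])]
  refine Finset.sum_le_sum fun i hi => ?_
  have hpos : 0 < Δ i := hΔ i (Finset.ne_of_mem_erase hi)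
  have hcard := card_pass_le (T := T) (r := r) (d := d) hord i
    (y := 4 * (c / Δ i ^ 2) + 1) (by positivity)
  have h2 := mul_le_mul_of_nonneg_right hcard hpos.le
  refine h2.trans ?_
  have h3 : 4 * (c / Δ i ^ 2) * Δ i = 256 * Real.log T / (q₀ * Δ i) := by
    rw [hc]; field_simp; norm_num
  have := hΔ1 i
  simp only [hΔdef] at *
  nlinarith

end Good

/-! ### Measurability of the pulled arm. -/

section Measurability

variable {K : ℕ}

theorem measurableSet_observed (a : ℕ → Fin K) (s t : ℕ) :
    MeasurableSet {h : ℕ → (Fin K → ℝ) × (Fin K → ℕ∞) | (s : ℕ∞) + (h s).2 (a s) < (t : ℕ∞)} := by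
  have h1 : Measurable fun h : ℕ → (Fin K → ℝ) × (Fin K → ℕ∞) => (h s).2 (a s) := by fun_prop
  exact h1 (MeasurableSet.of_discrete (s := {x : ℕ∞ | (s : ℕ∞) + x < (t : ℕ∞)}))

theorem measurable_numObs (a : ℕ → Fin K) (t : ℕ) (i : Fin K) :
    Measurable fun h : ℕ → (Fin K → ℝ) × (Fin K → ℕ∞) => numObs (fun s => (h s).2) a t i := by
  unfold numObs
  simp only [Finset.card_filter]
  refine Finset.measurable_sum _ fun s _ => ?_
  exact Measurable.ite ((MeasurableSet.const _).inter (measurableSet_observed a s t))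
    measurable_const measurable_const

theorem measurable_empMean (a : ℕ → Fin K) (t : ℕ) (i : Fin K) :
    Measurable fun h : ℕ → (Fin K → ℝ) × (Fin K → ℕ∞) =>
      empMean (fun s => (h s).1) (fun s => (h s).2) a t i := by
  unfold empMean
  simp only [Finset.sum_filter]
  refine Measurable.div (Finset.measurable_sum _ fun s _ => ?_) ?_
  · exact Measurable.ite ((MeasurableSet.const _).inter (measurableSet_observed a s t))
      (by fun_prop) measurable_const
  · exact (measurable_from_top (f := fun n : ℕ => ((max n 1 : ℕ) : ℝ))).comp
      (measurable_numObs a t i)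

theorem measurable_radius (T : ℕ) (a : ℕ → Fin K) (t : ℕ) (i : Fin K) :
    Measurable fun h : ℕ → (Fin K → ℝ) × (Fin K → ℕ∞) => radius T (fun s => (h s).2) a t i :=
  (measurable_from_top (f := fun n : ℕ =>
    Real.sqrt (2 * Real.log T / ((max n 1 : ℕ) : ℝ)))).comp (measurable_numObs a t i)

theorem measurableSet_keep_eq (T : ℕ) (a : ℕ → Fin K) (t : ℕ) (S S' : Finset (Fin K)) :
    MeasurableSet {h : ℕ → (Fin K → ℝ) × (Fin K → ℕ∞) |
      keep T (fun s => (h s).1) (fun s => (h s).2) a t S = S'} := by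
  have hlt : ∀ i j, MeasurableSet {h : ℕ → (Fin K → ℝ) × (Fin K → ℕ∞) |
      ucb T (fun s => (h s).1) (fun s => (h s).2) a t i <
        lcb T (fun s => (h s).1) (fun s => (h s).2) a t j} := fun i j =>
    measurableSet_lt ((measurable_empMean a t i).add (measurable_radius T a t i))
      ((measurable_empMean a t j).sub (measurable_radius T a t j))
  simp only [Finset.ext_iff, keep, Finset.mem_filter]
  rw [measurableSet_setOfPred]
  refine Measurable.forall fun i => Measurable.iff ?_ measurable_const
  refine Measurable.and measurable_const (Measurable.not (Measurable.exists fun j => ?_))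
  exact Measurable.and measurable_const (measurableSet_setOfPred.1 (hlt i j))

variable [NeZero K] (T : ℕ) (ord : ℕ → Finset (Fin K) → List (Fin K))

/-- The state of the algorithm, as a simple function of the realization. -/
theorem exists_simpleFunc_seState (t : ℕ) :
    ∃ F : SimpleFunc (ℕ → (Fin K → ℝ) × (Fin K → ℕ∞)) (SEState K),
      ∀ h, F h = seState T ord (fun s => (h s).1) (fun s => (h s).2) t := by
  induction t with
  | zero => exact ⟨SimpleFunc.const _ _, fun h => rfl⟩
  | succ t ih =>
    obtain ⟨F, hF⟩ := ih
    -- `SEState` carries no σ-algebra, but a `SimpleFunc` needs only measurable fibres and a finite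
    -- range. One round of the algorithm then becomes `SimpleFunc.bind`.
    let k : (ℕ → Fin K) → Finset (Fin K) →
        SimpleFunc (ℕ → (Fin K → ℝ) × (Fin K → ℕ∞)) (Finset (Fin K)) := fun a S =>
      { toFun := fun h => keep T (fun s => (h s).1) (fun s => (h s).2) a (t + 1) S
        measurableSet_fiber' := fun S' => measurableSet_keep_eq T a (t + 1) S S'
        finite_range' := Set.toFinite _ }
    let G : SEState K → SimpleFunc (ℕ → (Fin K → ℝ) × (Fin K → ℕ∞)) (SEState K) := fun x =>
      (k (Function.update x.pulled t x.next) x.active).map fun S =>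
        if x.queue.tail = [] then
          { pass := x.pass + 1, active := S, queue := ord (x.pass + 1) S,
            pulled := Function.update x.pulled t x.next }
        else
          { pass := x.pass, active := x.active, queue := x.queue.tail,
            pulled := Function.update x.pulled t x.next }
    refine ⟨F.bind G, fun h => ?_⟩
    rw [SimpleFunc.bind_apply, hF]
    rfl

theorem measurable_seArm (t : ℕ) :
    Measurable fun h : ℕ → (Fin K → ℝ) × (Fin K → ℕ∞) =>
      seArm T ord (fun s => (h s).1) (fun s => (h s).2) t := by
  obtain ⟨F, hF⟩ := exists_simpleFunc_seState T ord t
  have : (fun h : ℕ → (Fin K → ℝ) × (Fin K → ℕ∞) =>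
      seArm T ord (fun s => (h s).1) (fun s => (h s).2) t) = F.map SEState.next := by
    funext h
    rw [SimpleFunc.map_apply, hF]
    rfl
  rw [this]
  exact SimpleFunc.measurable _

end Measurability

/-! ### Supermartingale products without conditional expectations. -/

section Supermartingale

variable {Ω α β : Type*} [MeasurableSpace Ω] [MeasurableSpace α] [MeasurableSpace β]
  {P : Measure Ω} [IsProbabilityMeasure P]

/-- One supermartingale step: by independence and Tonelli, `V` is integrated first with `U` frozen.
-/
theorem lintegral_mul_le_of_indepFun {U : Ω → α} {V : Ω → β} (hU : Measurable U)
    (hV : Measurable V) (hind : IndepFun U V P) {G : α → ℝ≥0∞} (hG : Measurable G)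
    {g : α → β → ℝ≥0∞} (hg : Measurable (Function.uncurry g))
    (hle : ∀ u, ∫⁻ ω, g u (V ω) ∂P ≤ 1) :
    ∫⁻ ω, G (U ω) * g (U ω) (V ω) ∂P ≤ ∫⁻ ω, G (U ω) ∂P := by
  have hm : Measurable fun p : α × β => G p.1 * g p.1 p.2 := (hG.comp measurable_fst).mul hg
  have hgu : ∀ u, Measurable (g u) := fun u => hg.comp measurable_prodMk_left
  have h1 := (indepFun_iff_map_prod_eq_prod_map_map hU.aemeasurable hV.aemeasurable).1 hind
  have := Measure.isProbabilityMeasure_map (μ := P) hU.aemeasurable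
  have := Measure.isProbabilityMeasure_map (μ := P) hV.aemeasurable
  calc ∫⁻ ω, G (U ω) * g (U ω) (V ω) ∂P
      = ∫⁻ p, G p.1 * g p.1 p.2 ∂(P.map fun ω => (U ω, V ω)) := by
        rw [lintegral_map hm (hU.prodMk hV)]
    _ = ∫⁻ u, ∫⁻ v, G u * g u v ∂(P.map V) ∂(P.map U) := by
        rw [h1, lintegral_prod _ hm.aemeasurable]
    _ ≤ ∫⁻ u, G u ∂(P.map U) := by
        refine lintegral_mono fun u => ?_
        rw [lintegral_const_mul _ (hgu u), lintegral_map (hgu u) hV]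
        exact mul_le_of_le_one_right' (hle u)
    _ = ∫⁻ ω, G (U ω) ∂P := lintegral_map hG hU

/-- The sequence `h` with the entries from index `t` on replaced by `x₀`. -/
def past (x₀ : β) (t : ℕ) (h : ℕ → β) : ℕ → β := fun u => if u < t then h u else x₀

omit [MeasurableSpace β] in
theorem past_past (x₀ : β) {s t : ℕ} (hst : s ≤ t) (h : ℕ → β) :
    past x₀ s (past x₀ t h) = past x₀ s h := by
  funext u
  unfold past
  split_ifs with h1 h2
  · rfl
  · omega
  · rfl

theorem measurable_past (x₀ : β) (t : ℕ) : Measurable (past x₀ t) := by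
  refine measurable_pi_lambda _ fun u => ?_
  unfold past
  split_ifs
  · exact measurable_pi_apply u
  · exact measurable_const

omit [IsProbabilityMeasure P] in
theorem indepFun_past {X : ℕ → Ω → β} (hX : ∀ t, Measurable (X t)) (hind : iIndepFun X P)
    (x₀ : β) (t : ℕ) : IndepFun (fun ω => past x₀ t (fun u => X u ω)) (X t) P := by
  classical
  -- `past` is a measurable function of the coordinates below `t` alone, so independence of disjoint
  -- blocks suffices.
  have h := hind.indepFun_finset (Finset.range t) {t} (by simp) hX
  have hφ : Measurable fun (g : Finset.range t → β) (u : ℕ) =>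
      if hu : u ∈ Finset.range t then g ⟨u, hu⟩ else x₀ := by
    refine measurable_pi_lambda _ fun u => ?_
    split_ifs
    · exact measurable_pi_apply _
    · exact measurable_const
  have hψ : Measurable fun g : ({t} : Finset ℕ) → β => g ⟨t, by simp⟩ := measurable_pi_apply _
  have := h.comp hφ hψ
  convert this using 1
  · funext ω u
    simp [past]
  · rfl

theorem lintegral_prod_le_one {X : ℕ → Ω → β} (hX : ∀ t, Measurable (X t))
    (hind : iIndepFun X P) (x₀ : β) {f : ℕ → (ℕ → β) → β → ℝ≥0∞}
    (hf : ∀ s, Measurable (Function.uncurry (f s)))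
    (hle : ∀ s h, ∫⁻ ω, f s h (X s ω) ∂P ≤ 1) (t : ℕ) :
    ∫⁻ ω, ∏ s ∈ Finset.range t, f s (past x₀ s (fun u => X u ω)) (X s ω) ∂P ≤ 1 := by
  induction t with
  | zero => simp
  | succ t ih =>
    have hG : Measurable fun h : ℕ → β => ∏ s ∈ Finset.range t, f s (past x₀ s h) (h s) :=
      Finset.measurable_prod _ fun s _ =>
        (hf s).comp ((measurable_past x₀ s).prodMk (measurable_pi_apply s))
    have hGp : ∀ ω, ∏ s ∈ Finset.range t, f s (past x₀ s (past x₀ t (fun u => X u ω)))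
        (past x₀ t (fun u => X u ω) s) =
        ∏ s ∈ Finset.range t, f s (past x₀ s (fun u => X u ω)) (X s ω) := by
      intro ω
      refine Finset.prod_congr rfl fun s hs => ?_
      have hs' := Finset.mem_range.1 hs
      rw [past_past x₀ hs'.le]
      simp [past, hs']
    have h := lintegral_mul_le_of_indepFun
      ((measurable_past x₀ t).comp (measurable_pi_lambda _ hX)) (hX t) (indepFun_past hX hind x₀ t)
      hG (hf t) (hle t)
    simp only [Function.comp_apply, hGp] at h
    simp only [Finset.prod_range_succ]
    exact h.trans ih

end Supermartingale

/-! ### Exponential moments of rewards and delays along the pulls of one arm. -/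

section Concentration

variable {Ω : Type*} [MeasurableSpace Ω] {P : Measure Ω} {K : ℕ}
  {r : ℕ → Ω → Fin K → ℝ} {d : ℕ → Ω → Fin K → ℕ∞}

theorem IsRewardIndepDelayedBandit.measurable_pair (henv : IsRewardIndepDelayedBandit P r d)
    (t : ℕ) : Measurable fun ω => (r t ω, d t ω) :=
  (henv.measurable_reward t).prodMk (henv.measurable_delay t)

theorem IsRewardIndepDelayedBandit.measurable_reward_apply
    (henv : IsRewardIndepDelayedBandit P r d) (t : ℕ) (i : Fin K) :
    Measurable fun ω => r t ω i :=
  (measurable_pi_apply i).comp (henv.measurable_reward t)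

theorem IsRewardIndepDelayedBandit.measurableSet_delay
    (henv : IsRewardIndepDelayedBandit P r d) (t : ℕ) (i : Fin K) (A : Set ℕ∞) :
    MeasurableSet {ω | d t ω i ∈ A} :=
  ((measurable_pi_apply i).comp (henv.measurable_delay t)) (MeasurableSet.of_discrete (s := A))

theorem IsRewardIndepDelayedBandit.integral_reward (henv : IsRewardIndepDelayedBandit P r d)
    (t : ℕ) (i : Fin K) : ∫ ω, r t ω i ∂P = meanReward P r i :=
  ((henv.identDistrib t).comp ((measurable_pi_apply i).comp measurable_fst)).integral_eq

theorem IsRewardIndepDelayedBandit.measureReal_delay (henv : IsRewardIndepDelayedBandit P r d)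
    (t : ℕ) (i : Fin K) (γ : ℕ∞) : P.real {ω | d t ω i ≤ γ} = P.real {ω | d 0 ω i ≤ γ} := by
  have h := ((henv.identDistrib t).comp ((measurable_pi_apply i).comp measurable_snd)).measure_mem_eq
    (MeasurableSet.of_discrete (s := {x : ℕ∞ | x ≤ γ}))
  exact congrArg ENNReal.toReal h

variable [IsProbabilityMeasure P]

theorem IsRewardIndepDelayedBandit.integrable_reward (henv : IsRewardIndepDelayedBandit P r d)
    (t : ℕ) (i : Fin K) : Integrable (fun ω => r t ω i) P := by
  refine Integrable.of_mem_Icc 0 1 (henv.measurable_reward_apply t i).aemeasurable ?_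
  filter_upwards [henv.reward_mem t] with ω hω using hω i

theorem IsRewardIndepDelayedBandit.meanReward_mem (henv : IsRewardIndepDelayedBandit P r d)
    (i : Fin K) : meanReward P r i ∈ Set.Icc (0 : ℝ) 1 := by
  have h0 : 0 ≤ᵐ[P] fun ω => r 0 ω i := by
    filter_upwards [henv.reward_mem 0] with ω hω using (hω i).1
  have h1 : (fun ω => r 0 ω i) ≤ᵐ[P] fun _ => (1 : ℝ) := by
    filter_upwards [henv.reward_mem 0] with ω hω using (hω i).2
  refine ⟨integral_nonneg_of_ae h0, ?_⟩
  have := integral_mono_ae (henv.integrable_reward 0 i) (integrable_const 1) h1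
  simpa [meanReward] using this

omit [IsProbabilityMeasure P] in
theorem measure_le_of_lintegral_exp_le_one {Y : Ω → ℝ} (hY : Measurable Y)
    (h : ∫⁻ ω, ENNReal.ofReal (Real.exp (Y ω)) ∂P ≤ 1) (c : ℝ) :
    P {ω | c ≤ Y ω} ≤ ENNReal.ofReal (Real.exp (-c)) := by
  have h1 := mul_meas_ge_le_lintegral (μ := P)
    (f := fun ω => ENNReal.ofReal (Real.exp (Y ω))) (by fun_prop) (ENNReal.ofReal (Real.exp c))
  have h2 : P {ω | c ≤ Y ω} ≤
      P {ω | ENNReal.ofReal (Real.exp c) ≤ ENNReal.ofReal (Real.exp (Y ω))} :=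
    measure_mono fun ω hω => ENNReal.ofReal_le_ofReal (Real.exp_le_exp.2 hω)
  rw [Real.exp_neg, ENNReal.ofReal_inv_of_pos (Real.exp_pos c)]
  refine h2.trans ?_
  rw [← one_div, ENNReal.le_div_iff_mul_le (Or.inl (by simp [Real.exp_pos]))
    (Or.inl ENNReal.ofReal_ne_top), mul_comm]
  exact h1.trans h

/-- Hoeffding's lemma: a variable in `[0,1]` is sub-Gaussian with variance proxy `1/4`. -/
theorem IsRewardIndepDelayedBandit.lintegral_exp_reward
    (henv : IsRewardIndepDelayedBandit P r d) (t : ℕ) (i : Fin K) (l : ℝ) :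
    ∫⁻ ω, ENNReal.ofReal (Real.exp (l * (r t ω i - meanReward P r i) - l ^ 2 / 8)) ∂P ≤ 1 := by
  have hsub : HasSubgaussianMGF (fun ω => r t ω i - P[fun ω => r t ω i])
      ((‖(1 : ℝ) - 0‖₊ / 2) ^ 2) P := by
    refine hasSubgaussianMGF_of_mem_Icc (henv.measurable_reward_apply t i).aemeasurable ?_
    filter_upwards [henv.reward_mem t] with ω hω using hω i
  rw [henv.integral_reward] at hsub
  have hint := hsub.integrable_exp_mul l
  have hmgf := hsub.mgf_le l
  have hc : (((‖(1 : ℝ) - 0‖₊ / 2) ^ 2 : NNReal) : ℝ) * l ^ 2 / 2 = l ^ 2 / 8 := by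
    simp; ring
  rw [hc] at hmgf
  simp only [Real.exp_sub]
  rw [← ofReal_integral_eq_lintegral_ofReal (hint.div_const _)
    (Filter.Eventually.of_forall fun ω => by positivity), integral_div]
  refine ENNReal.ofReal_le_one.2 ((div_le_one (Real.exp_pos _)).2 hmgf)

/-- For an indicator of probability `p`, the mean of `exp (-indicator)` is `1 - (1 - e⁻¹) * p`, at
most `exp (-(1 - e⁻¹) * p)`. This multiplicative form loses no factor for small `p`. -/
theorem IsRewardIndepDelayedBandit.lintegral_exp_delay
    (henv : IsRewardIndepDelayedBandit P r d) (t : ℕ) (i : Fin K) (γ : ℕ) :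
    ∫⁻ ω, ENNReal.ofReal (Real.exp ((1 - Real.exp (-1)) * P.real {ω | d 0 ω i ≤ (γ : ℕ∞)} -
      if d t ω i ≤ (γ : ℕ∞) then 1 else 0)) ∂P ≤ 1 := by
  set p := P.real {ω | d 0 ω i ≤ (γ : ℕ∞)} with hp
  set c := (1 - Real.exp (-1)) * p with hc
  have hA : MeasurableSet {ω | d t ω i ≤ (γ : ℕ∞)} := henv.measurableSet_delay t i {x | x ≤ γ}
  have hfun : (fun ω => Real.exp (c - if d t ω i ≤ (γ : ℕ∞) then 1 else 0)) =
      fun ω => Real.exp c + ({ω | d t ω i ≤ (γ : ℕ∞)}).indicator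
        (fun _ => Real.exp c * (Real.exp (-1) - 1)) ω := by
    funext ω
    by_cases h : d t ω i ≤ (γ : ℕ∞)
    · rw [if_pos h, Set.indicator_of_mem (by exact h), sub_eq_add_neg, Real.exp_add]
      ring
    · rw [if_neg h, Set.indicator_of_notMem (by exact h), sub_zero, add_zero]
  have hi : Integrable (({ω | d t ω i ≤ (γ : ℕ∞)}).indicator
        (fun _ => Real.exp c * (Real.exp (-1) - 1))) P := (integrable_const _).indicator hA
  rw [← ofReal_integral_eq_lintegral_ofReal (by rw [hfun]; exact (integrable_const _).add hi)
    (Filter.Eventually.of_forall fun ω => by positivity), hfun,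
    integral_add (integrable_const _) hi, integral_indicator_const _ hA, henv.measureReal_delay,
    ← hp]
  simp only [integral_const, probReal_univ, smul_eq_mul, one_mul]
  refine ENNReal.ofReal_le_one.2 ?_
  have h1 : 1 - c ≤ Real.exp (-c) := by linarith [Real.add_one_le_exp (-c)]
  calc Real.exp c + p * (Real.exp c * (Real.exp (-1) - 1)) = Real.exp c * (1 - c) := by
        rw [hc]; ring
    _ ≤ Real.exp c * Real.exp (-c) := by gcongr
    _ = 1 := by rw [← Real.exp_add]; simp

variable [NeZero K] (T : ℕ) (ord : ℕ → Finset (Fin K) → List (Fin K))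

omit [IsProbabilityMeasure P] in
theorem IsRewardIndepDelayedBandit.measurable_seArm (henv : IsRewardIndepDelayedBandit P r d)
    (t : ℕ) : Measurable fun ω => seArm T ord (fun s => r s ω) (fun s => d s ω) t :=
  (DelayedBandit.measurable_seArm T ord t).comp
    (measurable_pi_lambda (fun ω s => (r s ω, d s ω)) henv.measurable_pair)

theorem seArm_past (t : ℕ) (h : ℕ → (Fin K → ℝ) × (Fin K → ℕ∞)) :
    seArm T ord (fun s => (past 0 t h s).1) (fun s => (past 0 t h s).2) t =
      seArm T ord (fun s => (h s).1) (fun s => (h s).2) t := by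
  refine seArm_congr (fun s hs => ?_) (fun s hs => ?_) <;> simp [past, hs]

/-- Exponential supermartingale bound for sums over the rounds in which arm `i` is pulled. -/
theorem IsRewardIndepDelayedBandit.lintegral_exp_sum (henv : IsRewardIndepDelayedBandit P r d)
    (i : Fin K) {g : ℕ → (Fin K → ℝ) × (Fin K → ℕ∞) → ℝ} (hg : ∀ s, Measurable (g s))
    (hle : ∀ s, ∫⁻ ω, ENNReal.ofReal (Real.exp (g s (r s ω, d s ω))) ∂P ≤ 1) (t : ℕ) :
    ∫⁻ ω, ENNReal.ofReal (Real.exp (∑ s ∈ Finset.range t,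
      if seArm T ord (fun s => r s ω) (fun s => d s ω) s = i then g s (r s ω, d s ω) else 0)) ∂P
        ≤ 1 := by
  have h := lintegral_prod_le_one henv.measurable_pair henv.iIndep 0
    (f := fun s h x => ENNReal.ofReal (Real.exp
      (if seArm T ord (fun u => (h u).1) (fun u => (h u).2) s = i then g s x else 0)))
    (fun s => by
      refine ENNReal.measurable_ofReal.comp (Real.measurable_exp.comp (Measurable.ite ?_
        ((hg s).comp measurable_snd) measurable_const))
      exact ((DelayedBandit.measurable_seArm T ord s).comp measurable_fst)
        (measurableSet_singleton i))
    (fun s h => by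
      split_ifs
      · exact hle s
      · simp) t
  simp only [seArm_past] at h
  refine le_trans (lintegral_mono fun ω => le_of_eq ?_) h
  rw [Real.exp_sum, ENNReal.ofReal_prod_of_nonneg fun _ _ => (Real.exp_pos _).le]

theorem IsRewardIndepDelayedBandit.measure_sum_ge_le (henv : IsRewardIndepDelayedBandit P r d)
    (i : Fin K) {g : ℕ → (Fin K → ℝ) × (Fin K → ℕ∞) → ℝ} (hg : ∀ s, Measurable (g s))
    (hle : ∀ s, ∫⁻ ω, ENNReal.ofReal (Real.exp (g s (r s ω, d s ω))) ∂P ≤ 1) (t : ℕ) (c : ℝ) :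
    P {ω | c ≤ ∑ s ∈ Finset.range t,
      if seArm T ord (fun s => r s ω) (fun s => d s ω) s = i then g s (r s ω, d s ω) else 0} ≤
      ENNReal.ofReal (Real.exp (-c)) := by
  refine measure_le_of_lintegral_exp_le_one (Finset.measurable_sum _ fun s _ => ?_)
    (henv.lintegral_exp_sum T ord i hg hle t) c
  exact Measurable.ite (henv.measurable_seArm T ord s (measurableSet_singleton i))
    ((hg s).comp (henv.measurable_pair s)) measurable_const

/-- Increment of the reward supermartingale of arm `i`: feedback that arrives before round `t`. -/
noncomputable def rewardIncr (m l : ℝ) (i : Fin K) (t s : ℕ)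
    (x : (Fin K → ℝ) × (Fin K → ℕ∞)) : ℝ :=
  if (s : ℕ∞) + x.2 i < (t : ℕ∞) then l * (x.1 i - m) - l ^ 2 / 8 else 0

omit [NeZero K] in
theorem measurable_rewardIncr (m l : ℝ) (i : Fin K) (t s : ℕ) :
    Measurable (rewardIncr m l i t s) := by
  have h2 : Measurable fun x : (Fin K → ℝ) × (Fin K → ℕ∞) => x.2 i := by fun_prop
  refine Measurable.ite ?_ (by fun_prop) measurable_const
  exact h2 (MeasurableSet.of_discrete (s := {y : ℕ∞ | (s : ℕ∞) + y < (t : ℕ∞)}))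

-- Given the delay vector, the indicator that the feedback arrives before `t` is constant, while
-- independence leaves the reward law unchanged. So selecting the observed items creates no bias.
omit [NeZero K] in
theorem IsRewardIndepDelayedBandit.lintegral_exp_rewardIncr
    (henv : IsRewardIndepDelayedBandit P r d) (l : ℝ) (i : Fin K) (t s : ℕ) :
    ∫⁻ ω, ENNReal.ofReal (Real.exp
      (rewardIncr (meanReward P r i) l i t s (r s ω, d s ω))) ∂P ≤ 1 := by
  have hm : Measurable fun p : (Fin K → ℕ∞) × (Fin K → ℝ) => ENNReal.ofReal (Real.exp
      (rewardIncr (meanReward P r i) l i t s (p.2, p.1))) :=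
    ENNReal.measurable_ofReal.comp (Real.measurable_exp.comp
      ((measurable_rewardIncr _ l i t s).comp measurable_swap))
  have h := lintegral_mul_le_of_indepFun (henv.measurable_delay s) (henv.measurable_reward s)
    (henv.rewardIndep s).symm (G := fun _ => 1) measurable_const
    (g := fun δ ρ => ENNReal.ofReal (Real.exp (rewardIncr (meanReward P r i) l i t s (ρ, δ)))) hm
    (fun δ => by
      unfold rewardIncr
      by_cases hδ : (s : ℕ∞) + δ i < (t : ℕ∞)
      · simp only [hδ, if_true]
        exact henv.lintegral_exp_reward s i l
      · simp [hδ])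
  simpa using h

end Concentration

/-! ### From failure of the good event to large exponents. -/

section Deviation

variable {K : ℕ}

theorem sum_rewardIncr_eq (r : ℕ → Fin K → ℝ) (d : ℕ → Fin K → ℕ∞) (a : ℕ → Fin K) (m l : ℝ)
    (i : Fin K) (t : ℕ) :
    ∑ s ∈ Finset.range t, (if a s = i then rewardIncr m l i t s (r s, d s) else 0) =
      l * (empMean r d a t i * (max (numObs d a t i) 1 : ℕ) - numObs d a t i * m) -
        l ^ 2 / 8 * numObs d a t i := by
  have hmax : (((max (numObs d a t i) 1 : ℕ)) : ℝ) ≠ 0 := by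
    exact_mod_cast (by omega : max (numObs d a t i) 1 ≠ 0)
  have hmul : empMean r d a t i * (max (numObs d a t i) 1 : ℕ) =
      ∑ s ∈ (Finset.range t).filter (fun s => a s = i ∧ (s : ℕ∞) + d s (a s) < (t : ℕ∞)),
        r s (a s) := by
    unfold empMean
    rw [div_mul_cancel₀ _ hmax]
  have hsum : ∑ s ∈ Finset.range t, (if a s = i then rewardIncr m l i t s (r s, d s) else 0) =
      ∑ s ∈ (Finset.range t).filter (fun s => a s = i ∧ (s : ℕ∞) + d s (a s) < (t : ℕ∞)),
        (l * (r s (a s) - m) - l ^ 2 / 8) := by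
    rw [Finset.sum_filter]
    refine Finset.sum_congr rfl fun s _ => ?_
    by_cases h : a s = i
    · simp [h, rewardIncr]
    · simp [h]
  rw [hsum, hmul, Finset.sum_sub_distrib, ← Finset.mul_sum, Finset.sum_sub_distrib,
    Finset.sum_const, Finset.sum_const, nsmul_eq_mul, nsmul_eq_mul]
  unfold numObs
  ring

/-- Parameter of the exponential supermartingale for `n` observations. -/
noncomputable def expParam (T n : ℕ) : ℝ := 4 * Real.sqrt (2 * Real.log T / n)

/-- The best exponential parameter depends on the random number of observations, hence one candidate
for each value `n`. With radius `w`, the choice `l = 4 * w` yields `l * n * w - l² * n / 8 = 2 * n *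
w² = 4 * log T`. -/
theorem exists_large_sum_of_deviation {r : ℕ → Fin K → ℝ} {d : ℕ → Fin K → ℕ∞} {a : ℕ → Fin K}
    {m : ℝ} (hm : m ∈ Set.Icc (0 : ℝ) 1) {T t : ℕ} (hT : 2 ≤ T) (ht : t < T) {i : Fin K}
    (h : ¬ |empMean r d a t i - m| ≤ radius T d a t i) :
    ∃ n ∈ Finset.range T,
      4 * Real.log T ≤ ∑ s ∈ Finset.range t,
        (if a s = i then rewardIncr m (expParam T n) i t s (r s, d s) else 0) ∨
      4 * Real.log T ≤ ∑ s ∈ Finset.range t,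
        (if a s = i then rewardIncr m (-expParam T n) i t s (r s, d s) else 0) := by
  have hL : 0 < Real.log T := Real.log_pos (by exact_mod_cast hT)
  have hL2 : 1 / 2 ≤ Real.log T := by
    have h1 : Real.log 2 ≤ Real.log T := Real.log_le_log (by norm_num) (by exact_mod_cast hT)
    linarith [Real.log_two_gt_d9]
  rw [not_le] at h
  -- Without observations the empirical mean is 0 and the radius is at least 1, so no deviation is
  -- possible.
  have hn : numObs d a t i ≠ 0 := by
    intro h0
    have he : empMean r d a t i = 0 := by
      unfold empMean
      rw [Finset.card_eq_zero.1 h0]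
      simp
    have hr : 1 ≤ radius T d a t i := by
      unfold radius
      rw [h0]
      refine Real.le_sqrt_of_sq_le ?_
      simp
      linarith
    rw [he, zero_sub, abs_neg, abs_of_nonneg hm.1] at h
    linarith [hm.2]
  refine ⟨numObs d a t i, Finset.mem_range.2 (lt_of_le_of_lt ?_ ht), ?_⟩
  · exact (Finset.card_filter_le _ _).trans (by simp)
  have hmax : max (numObs d a t i) 1 = numObs d a t i := by omega
  rw [sum_rewardIncr_eq, sum_rewardIncr_eq, hmax]
  unfold radius at h
  rw [hmax] at h
  unfold expParam
  have hn0 : (0 : ℝ) < numObs d a t i := by exact_mod_cast Nat.pos_of_ne_zero hn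
  set n : ℝ := (numObs d a t i : ℝ) with hndef
  set w := Real.sqrt (2 * Real.log T / n) with hw
  have hw0 : 0 ≤ w := Real.sqrt_nonneg _
  have hw2 : n * w ^ 2 = 2 * Real.log T := by
    rw [hw, Real.sq_sqrt (by positivity)]
    field_simp
  set e := empMean r d a t i
  rcases lt_abs.1 h with h | h
  · left
    have := mul_le_mul_of_nonneg_left h.le (mul_nonneg hn0.le hw0)
    nlinarith
  · right
    have := mul_le_mul_of_nonneg_left h.le (mul_nonneg hn0.le hw0)
    nlinarith

/-- As `1 - e⁻¹ ≥ 5/8`, the exponent is at least `(5/8 - 1/2) * q * numPulls`. The threshold `32 *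
L` turns this eighth into `4 * L`. -/
theorem large_sum_of_few_observed {d : ℕ → Fin K → ℕ∞} {a : ℕ → Fin K} {t γ : ℕ} {i : Fin K}
    {L p q : ℝ} (hqp : q ≤ p) (h1 : 32 * L ≤ q * numPulls a t i) (hL : 0 ≤ L)
    (h2 : (((Finset.range t).filter (fun s => a s = i ∧ d s i ≤ (γ : ℕ∞))).card : ℝ) <
      q * numPulls a t i / 2) :
    4 * L ≤ ∑ s ∈ Finset.range t, (if a s = i then
      (1 - Real.exp (-1)) * p - (if d s i ≤ (γ : ℕ∞) then 1 else 0) else 0) := by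
  have hsum : ∑ s ∈ Finset.range t, (if a s = i then
      (1 - Real.exp (-1)) * p - (if d s i ≤ (γ : ℕ∞) then (1 : ℝ) else 0) else 0) =
      numPulls a t i * ((1 - Real.exp (-1)) * p) -
        ((Finset.range t).filter (fun s => a s = i ∧ d s i ≤ (γ : ℕ∞))).card := by
    rw [← Finset.sum_filter, Finset.sum_sub_distrib, Finset.sum_const, nsmul_eq_mul,
      Finset.sum_boole, Finset.filter_filter]
    rfl
  rw [hsum]
  have he : Real.exp (-1) ≤ 3 / 8 := by linarith [Real.exp_neg_one_lt_d9]
  have h3 : q * numPulls a t i ≤ p * numPulls a t i := by gcongr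
  nlinarith

end Deviation

/-! ### Probability of a bad path. -/

section Bad

variable {Ω : Type*} [MeasurableSpace Ω] {P : Measure Ω} [IsProbabilityMeasure P] {K : ℕ}
  [NeZero K] {r : ℕ → Ω → Fin K → ℝ} {d : ℕ → Ω → Fin K → ℕ∞}

theorem IsRewardIndepDelayedBandit.measure_not_isGoodPath_le
    (henv : IsRewardIndepDelayedBandit P r d) {T : ℕ} (hT : 2 ≤ T)
    (ord : ℕ → Finset (Fin K) → List (Fin K)) {q : Fin K → ℝ} {γ : Fin K → ℕ}
    (hγ : ∀ i, q i ≤ P.real {ω | d 0 ω i ≤ (γ i : ℕ∞)}) :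
    P {ω | ¬ IsGoodPath T ord (fun s => r s ω) (fun s => d s ω) (meanReward P r) q γ} ≤
      T * (K * (T * (2 * ENNReal.ofReal (Real.exp (-(4 * Real.log T)))) +
        ENNReal.ofReal (Real.exp (-(4 * Real.log T))))) := by
  have hL : 0 < Real.log T := Real.log_pos (by exact_mod_cast hT)
  set ε := ENNReal.ofReal (Real.exp (-(4 * Real.log T))) with hε
  let a : Ω → ℕ → Fin K := fun ω => seArm T ord (fun s => r s ω) (fun s => d s ω)
  let A : ℝ → ℕ → Fin K → Set Ω := fun l t i => {ω | 4 * Real.log T ≤ ∑ s ∈ Finset.range t,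
    if a ω s = i then rewardIncr (meanReward P r i) l i t s (r s ω, d s ω) else 0}
  let B : ℕ → Fin K → Set Ω := fun t i => {ω | 4 * Real.log T ≤ ∑ s ∈ Finset.range t,
    if a ω s = i then (1 - Real.exp (-1)) * P.real {ω | d 0 ω i ≤ (γ i : ℕ∞)} -
      (if d s ω i ≤ (γ i : ℕ∞) then 1 else 0) else 0}
  have hA : ∀ l t i, P (A l t i) ≤ ε := fun l t i =>
    henv.measure_sum_ge_le T ord i (fun s => measurable_rewardIncr _ l i t s)
      (henv.lintegral_exp_rewardIncr l i t) t _
  have hB : ∀ t i, P (B t i) ≤ ε := fun t i =>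
    henv.measure_sum_ge_le T ord i (g := fun _ x => (1 - Real.exp (-1)) *
      P.real {ω | d 0 ω i ≤ (γ i : ℕ∞)} - (if x.2 i ≤ (γ i : ℕ∞) then 1 else 0))
      (fun s => by
        have h2 : Measurable fun x : (Fin K → ℝ) × (Fin K → ℕ∞) => x.2 i := by fun_prop
        refine measurable_const.sub (Measurable.ite ?_ measurable_const measurable_const)
        exact h2 (MeasurableSet.of_discrete (s := {y : ℕ∞ | y ≤ (γ i : ℕ∞)})))
      (fun s => henv.lintegral_exp_delay s i (γ i)) t _
  -- For each round and arm there are `2 * T` reward events (a parameter and a sign) and one delay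
  -- event.
  have hsub : {ω | ¬ IsGoodPath T ord (fun s => r s ω) (fun s => d s ω) (meanReward P r) q γ} ⊆
      ⋃ t ∈ Finset.range T, ⋃ i ∈ (Finset.univ : Finset (Fin K)),
        ((⋃ n ∈ Finset.range T, (A (expParam T n) t i ∪ A (-expParam T n) t i)) ∪ B t i) := by
    intro ω hω
    by_contra hc
    simp only [Set.mem_iUnion, Set.mem_union, not_exists, not_or] at hc
    refine hω ⟨fun t ht i => ?_, fun t ht i h1 => ?_⟩
    · by_contra hdev
      obtain ⟨n, hn, h⟩ := exists_large_sum_of_deviation (henv.meanReward_mem i) hT ht hdev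
      have := (hc t (Finset.mem_range.2 ht) i (Finset.mem_univ i)).1 n hn
      exact h.elim this.1 this.2
    · by_contra hfew
      exact (hc t (Finset.mem_range.2 ht) i (Finset.mem_univ i)).2
        (large_sum_of_few_observed (hγ i) h1 hL.le (not_le.1 hfew))
  calc _ ≤ _ := measure_mono hsub
    _ ≤ ∑ t ∈ Finset.range T, P (⋃ i ∈ (Finset.univ : Finset (Fin K)),
        ((⋃ n ∈ Finset.range T, (A (expParam T n) t i ∪ A (-expParam T n) t i)) ∪ B t i)) :=
      measure_biUnion_finset_le _ _
    _ ≤ ∑ t ∈ Finset.range T, ∑ i : Fin K, P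
        ((⋃ n ∈ Finset.range T, (A (expParam T n) t i ∪ A (-expParam T n) t i)) ∪ B t i) :=
      Finset.sum_le_sum fun t _ => measure_biUnion_finset_le _ _
    _ ≤ ∑ t ∈ Finset.range T, ∑ i : Fin K, (∑ n ∈ Finset.range T, 2 * ε + ε) := by
      refine Finset.sum_le_sum fun t _ => Finset.sum_le_sum fun i _ => ?_
      refine (measure_union_le _ _).trans (add_le_add ?_ (hB t i))
      refine (measure_biUnion_finset_le _ _).trans (Finset.sum_le_sum fun n _ => ?_)
      rw [two_mul]
      exact (measure_union_le _ _).trans (add_le_add (hA _ t i) (hA _ t i))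
    _ = _ := by simp [mul_add]

theorem IsRewardIndepDelayedBandit.mul_measureReal_not_isGoodPath_le
    (henv : IsRewardIndepDelayedBandit P r d) {T : ℕ} (hT : 2 ≤ T)
    (ord : ℕ → Finset (Fin K) → List (Fin K)) {q : Fin K → ℝ} {γ : Fin K → ℕ}
    (hγ : ∀ i, q i ≤ P.real {ω | d 0 ω i ≤ (γ i : ℕ∞)}) :
    T * P.real {ω | ¬ IsGoodPath T ord (fun s => r s ω) (fun s => d s ω) (meanReward P r) q γ} ≤
      5 / 4 * K := by
  have h := ENNReal.toReal_mono (by finiteness) (henv.measure_not_isGoodPath_le hT ord hγ)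
  have hT' : (2 : ℝ) ≤ T := by exact_mod_cast hT
  have hexp : Real.exp (-(4 * Real.log T)) = 1 / (T : ℝ) ^ 4 := by
    rw [Real.exp_neg, mul_comm, Real.exp_mul, Real.exp_log (by positivity), one_div]
    norm_cast
  rw [hexp, ENNReal.toReal_mul, ENNReal.toReal_mul, ENNReal.toReal_add (by finiteness)
    (by finiteness), ENNReal.toReal_mul, ENNReal.toReal_mul, ENNReal.toReal_ofReal (by positivity)]
    at h
  simp only [ENNReal.toReal_natCast, ENNReal.toReal_ofNat] at h
  calc _ ≤ (T : ℝ) * (T * (K * (T * (2 * (1 / (T : ℝ) ^ 4)) + 1 / (T : ℝ) ^ 4))) := by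
        gcongr
        exact h
    _ = K * ((2 * T + 1) / (T : ℝ) ^ 2) := by field_simp
    _ ≤ K * (5 / 4) := by
        refine mul_le_mul_of_nonneg_left ?_ (Nat.cast_nonneg K)
        rw [div_le_iff₀ (by positivity)]
        nlinarith
    _ = _ := mul_comm _ _

end Bad

/-! ### From good paths to expected pseudo-regret. -/

section Regret

variable {Ω : Type*} [MeasurableSpace Ω] {P : Measure Ω} [IsProbabilityMeasure P] {K : ℕ}
  [NeZero K] {r : ℕ → Ω → Fin K → ℝ} {d : ℕ → Ω → Fin K → ℕ∞}

omit [IsProbabilityMeasure P] in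
theorem IsRewardIndepDelayedBandit.indepFun_seArm (henv : IsRewardIndepDelayedBandit P r d)
    (T : ℕ) (ord : ℕ → Finset (Fin K) → List (Fin K)) (t : ℕ) :
    IndepFun (fun ω => seArm T ord (fun s => r s ω) (fun s => d s ω) t) (r t) P := by
  have h := (indepFun_past henv.measurable_pair henv.iIndep 0 t).comp
    (DelayedBandit.measurable_seArm T ord t) measurable_fst
  convert h using 1
  · funext ω
    exact (seArm_past T ord t fun u => (r u ω, d u ω)).symm
  · rfl

omit [NeZero K] in
theorem integrable_comp_fin {a : Ω → Fin K} (ha : Measurable a) (μ : Fin K → ℝ) :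
    Integrable (fun ω => μ (a ω)) P := by
  have hm : Measurable fun ω => μ (a ω) := measurable_from_top.comp ha
  refine Integrable.of_bound hm.aestronglyMeasurable (∑ i, ‖μ i‖)
    (Filter.Eventually.of_forall fun ω => ?_)
  exact Finset.single_le_sum (f := fun i => ‖μ i‖) (fun i _ => norm_nonneg _)
    (Finset.mem_univ (a ω))

/-- The pulled arm is a function of earlier rounds, hence independent of the reward vector of round
`t`; splitting over its finitely many values factors the expectation. -/
theorem IsRewardIndepDelayedBandit.integral_reward_seArm
    (henv : IsRewardIndepDelayedBandit P r d)
    (T : ℕ) (ord : ℕ → Finset (Fin K) → List (Fin K)) (t : ℕ) :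
    Integrable (fun ω => r t ω (seArm T ord (fun s => r s ω) (fun s => d s ω) t)) P ∧
    ∫ ω, r t ω (seArm T ord (fun s => r s ω) (fun s => d s ω) t) ∂P =
      ∫ ω, meanReward P r (seArm T ord (fun s => r s ω) (fun s => d s ω) t) ∂P := by
  set a : Ω → Fin K := fun ω => seArm T ord (fun s => r s ω) (fun s => d s ω) t with ha
  have hma : Measurable a := henv.measurable_seArm T ord t
  have hind : ∀ i, Measurable fun j : Fin K => if j = i then (1 : ℝ) else 0 :=
    fun i => measurable_from_top
  have hsum : ∀ μ : Fin K → ℝ, ∀ ω, μ (a ω) = ∑ i, (if a ω = i then (1 : ℝ) else 0) * μ i := by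
    intro μ ω
    simp
  have hint : ∀ i, Integrable (fun ω => (if a ω = i then (1 : ℝ) else 0) * r t ω i) P := by
    intro i
    refine Integrable.of_mem_Icc 0 1
      ((((hind i).comp hma).mul (henv.measurable_reward_apply t i)).aemeasurable) ?_
    filter_upwards [henv.reward_mem t] with ω hω
    split_ifs
    · simpa using hω i
    · simp
  have h1 : (fun ω => r t ω (a ω)) = fun ω => ∑ i, (if a ω = i then (1 : ℝ) else 0) * r t ω i :=
    funext fun ω => hsum (r t ω) ω
  have h2 : (fun ω => meanReward P r (a ω)) =
      fun ω => ∑ i, (if a ω = i then (1 : ℝ) else 0) * meanReward P r i :=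
    funext fun ω => hsum (meanReward P r) ω
  rw [h1, h2]
  refine ⟨integrable_finsetSum _ fun i _ => hint i, ?_⟩
  rw [integral_finsetSum _ fun i _ => hint i, integral_finsetSum _ fun i _ =>
    (integrable_comp_fin hma fun j => if j = i then (1 : ℝ) else 0).mul_const _]
  refine Finset.sum_congr rfl fun i _ => ?_
  rw [integral_mul_const, (henv.indepFun_seArm T ord t).integral_fun_comp_mul_comp
    (f := fun j => if j = i then (1 : ℝ) else 0) (g := fun x => x i) hma.aemeasurable
    (henv.measurable_reward t).aemeasurable (hind i).aestronglyMeasurable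
    (measurable_pi_apply i).aestronglyMeasurable, henv.integral_reward]

/-- The pseudo-regret is at most the expected sum of the gaps of the pulled arms. -/
theorem IsRewardIndepDelayedBandit.pseudoRegret_le (henv : IsRewardIndepDelayedBandit P r d)
    (T : ℕ) (ord : ℕ → Finset (Fin K) → List (Fin K)) {istar : Fin K}
    (hstar : ∀ i, meanReward P r i ≤ meanReward P r istar) :
    pseudoRegret P r (fun t ω => seArm T ord (fun s => r s ω) (fun s => d s ω) t) T ≤
      ∫ ω, ∑ t ∈ Finset.range T, (meanReward P r istar -
        meanReward P r (seArm T ord (fun s => r s ω) (fun s => d s ω) t)) ∂P := by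
  have hi : ∀ t, Integrable (fun ω =>
      meanReward P r (seArm T ord (fun s => r s ω) (fun s => d s ω) t)) P :=
    fun t => integrable_comp_fin (henv.measurable_seArm T ord t) _
  have hs : ∀ t, Integrable (fun ω => meanReward P r istar -
      meanReward P r (seArm T ord (fun s => r s ω) (fun s => d s ω) t)) P :=
    fun t => (integrable_const _).sub (hi t)
  unfold pseudoRegret
  rw [integral_finsetSum _ fun t _ => (henv.integral_reward_seArm T ord t).1,
    integral_finsetSum _ fun t _ => hs t]
  simp only [(henv.integral_reward_seArm T ord _).2]
  have h1 : ∀ t, ∫ ω, (meanReward P r istar -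
      meanReward P r (seArm T ord (fun s => r s ω) (fun s => d s ω) t)) ∂P =
      meanReward P r istar -
        ∫ ω, meanReward P r (seArm T ord (fun s => r s ω) (fun s => d s ω) t) ∂P := by
    intro t
    rw [integral_sub (integrable_const _) (hi t)]
    simp
  simp only [h1, Finset.sum_sub_distrib]
  refine sub_le_sub_right (ciSup_le fun i => ?_) _
  rw [integral_finsetSum _ fun t _ => henv.integrable_reward t i]
  refine Finset.sum_le_sum fun t _ => ?_
  rw [henv.integral_reward]
  exact hstar i

/-- A bound on the sum of the gaps on good paths bounds the pseudo-regret. -/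
theorem IsRewardIndepDelayedBandit.pseudoRegret_le_of_isGoodPath
    (henv : IsRewardIndepDelayedBandit P r d) {T : ℕ} (hT : 2 ≤ T)
    (ord : ℕ → Finset (Fin K) → List (Fin K)) {istar : Fin K}
    (hstar : ∀ i, meanReward P r i ≤ meanReward P r istar) {q : Fin K → ℝ} {γ : Fin K → ℕ}
    (hγ : ∀ i, q i ≤ P.real {ω | d 0 ω i ≤ (γ i : ℕ∞)}) {C : ℝ} (hC : 0 ≤ C)
    (hgood : ∀ ω, IsGoodPath T ord (fun s => r s ω) (fun s => d s ω) (meanReward P r) q γ →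
      ∑ t ∈ Finset.range T, (meanReward P r istar -
        meanReward P r (seArm T ord (fun s => r s ω) (fun s => d s ω) t)) ≤ C) :
    pseudoRegret P r (fun t ω => seArm T ord (fun s => r s ω) (fun s => d s ω) t) T ≤
      C + 5 / 4 * K := by
  refine (henv.pseudoRegret_le T ord hstar).trans ?_
  set N := {ω | ¬ IsGoodPath T ord (fun s => r s ω) (fun s => d s ω) (meanReward P r) q γ}
  -- A measurable hull of the bad set has the same measure, so measurability of `IsGoodPath` is not
  -- needed. On it each round costs at most 1.
  set B := toMeasurable P N
  have hB : MeasurableSet B := measurableSet_toMeasurable P N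
  have hint : Integrable (fun ω => C + B.indicator (fun _ => (T : ℝ)) ω) P :=
    (integrable_const _).add ((integrable_const _).indicator hB)
  have hle : ∀ ω, ∑ t ∈ Finset.range T, (meanReward P r istar -
        meanReward P r (seArm T ord (fun s => r s ω) (fun s => d s ω) t)) ≤
      C + B.indicator (fun _ => (T : ℝ)) ω := by
    intro ω
    by_cases hω : ω ∈ B
    · rw [Set.indicator_of_mem hω]
      have : ∑ t ∈ Finset.range T, (meanReward P r istar -
          meanReward P r (seArm T ord (fun s => r s ω) (fun s => d s ω) t)) ≤
          ∑ t ∈ Finset.range T, (1 : ℝ) := by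
        refine Finset.sum_le_sum fun t _ => ?_
        linarith [(henv.meanReward_mem istar).2,
          (henv.meanReward_mem (seArm T ord (fun s => r s ω) (fun s => d s ω) t)).1]
      simp only [Finset.sum_const, Finset.card_range, nsmul_eq_mul, mul_one] at this
      linarith
    · rw [Set.indicator_of_notMem hω, add_zero]
      refine hgood ω ?_
      by_contra hbad
      exact hω (subset_toMeasurable P N hbad)
  refine (integral_mono (integrable_finsetSum _ fun t _ => (integrable_const _).sub
    (integrable_comp_fin (henv.measurable_seArm T ord t) _)) hint hle).trans ?_
  rw [integral_add (integrable_const _) ((integrable_const _).indicator hB),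
    integral_indicator_const _ hB]
  simp only [integral_const, probReal_univ, smul_eq_mul, one_mul]
  have hN : P.real B = P.real N := by
    unfold Measure.real
    rw [measure_toMeasurable]
  rw [hN, mul_comm]
  exact add_le_add_right (henv.mul_measureReal_not_isGoodPath_le hT ord hγ) C

theorem half_le_log {T : ℕ} (hT : 2 ≤ T) : 1 / 2 ≤ Real.log T := by
  have h1 : Real.log 2 ≤ Real.log T := Real.log_le_log (by norm_num) (by exact_mod_cast hT)
  linarith [Real.log_two_gt_d9]

-- Spreads the cost of bad paths over the `K - 1` suboptimal arms, using `K ≤ 2 * (K - 1)`.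
omit [NeZero K] in
theorem natCast_le_sum_erase (hK : 2 ≤ K) (i : Fin K) :
    5 / 4 * (K : ℝ) ≤ ∑ _j ∈ Finset.univ.erase i, (5 / 2 : ℝ) := by
  have hc : (Finset.univ.erase i).card = K - 1 := by simp
  rw [Finset.sum_const, hc, nsmul_eq_mul, Nat.cast_sub (by omega)]
  have : (2 : ℝ) ≤ K := by exact_mod_cast hK
  push_cast
  linarith

theorem IsRewardIndepDelayedBandit.pseudoRegret_le_quantiles
    (henv : IsRewardIndepDelayedBandit P r d) {T : ℕ} (hT : 2 ≤ T)
    {ord : ℕ → Finset (Fin K) → List (Fin K)} (hord : IsPullOrder ord) (hK : 2 ≤ K)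
    {istar : Fin K} {Δ : Fin K → ℝ}
    (hΔ : ∀ i, Δ i = meanReward P r istar - meanReward P r i) (hpos : ∀ i ≠ istar, 0 < Δ i)
    {q : Fin K → ℝ} (hq : ∀ i, q i ∈ Set.Ioc (0 : ℝ) 1) {γ : Fin K → ℕ}
    (hγ : ∀ i, q i ≤ P.real {ω | d 0 ω i ≤ (γ i : ℕ∞)}) {B : ℝ} (hB0 : 0 ≤ B)
    (hB : ∀ i ≠ istar, (γ i + γ istar : ℕ) * Δ i ≤ B) :
    pseudoRegret P r (fun t ω => seArm T ord (fun s => r s ω) (fun s => d s ω) t) T ≤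
      ∑ i ∈ Finset.univ.erase istar, 40 * Real.log T / Δ i * (1 / q i + 1 / q istar) +
        Real.log K * B := by
  have hL := half_le_log hT
  simp only [hΔ] at hpos hB ⊢
  have hstar : ∀ i, meanReward P r i ≤ meanReward P r istar := fun i => by
    by_cases h : i = istar
    · rw [h]
    · linarith [hpos i h]
  have hΔ1 : ∀ i, meanReward P r istar - meanReward P r i ≤ 1 := fun i => by
    linarith [(henv.meanReward_mem istar).2, (henv.meanReward_mem i).1]
  have hinv : ∀ i, 1 ≤ 1 / q i := fun i => (one_le_div (hq i).1).2 (hq i).2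
  have hlogK : 0 ≤ Real.log K := Real.log_natCast_nonneg K
  refine (henv.pseudoRegret_le_of_isGoodPath hT ord hstar hγ (add_nonneg (Finset.sum_nonneg
    fun i hi => ?_) (mul_nonneg hlogK hB0)) fun ω hω => hω.sum_gap_le hord hT hstar
      (fun i => (hq i).1) hpos hΔ1 hB0 hB).trans ?_
  · have := hpos i (Finset.ne_of_mem_erase hi)
    have := hinv i
    have := hinv istar
    positivity
  · rw [add_right_comm]
    refine add_le_add_left ((add_le_add_right (natCast_le_sum_erase hK istar) _).trans ?_) _
    rw [← Finset.sum_add_distrib]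
    refine Finset.sum_le_sum fun i hi => ?_
    have hp := hpos i (Finset.ne_of_mem_erase hi)
    set δ := meanReward P r istar - meanReward P r i
    -- The additive `3 + 5/2` per arm is absorbed by the difference `40 - 32 = 8`, since `1 / q i +
    -- 1 / q istar ≥ 2`.
    have h1 : 4 ≤ 8 * Real.log T / δ := by
      rw [le_div_iff₀ hp]
      nlinarith [hΔ1 i]
    have h2 : (4 : ℝ) * 2 ≤ 8 * Real.log T / δ * (1 / q i + 1 / q istar) :=
      mul_le_mul h1 (by linarith [hinv i, hinv istar]) (by norm_num) (by linarith)
    have h3 : 40 * Real.log T / δ * (1 / q i + 1 / q istar) =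
        32 * Real.log T / δ * (1 / q i + 1 / q istar) +
          8 * Real.log T / δ * (1 / q i + 1 / q istar) := by ring
    linarith

theorem IsRewardIndepDelayedBandit.pseudoRegret_le_single_quantile
    (henv : IsRewardIndepDelayedBandit P r d) {T : ℕ} (hT : 2 ≤ T)
    {ord : ℕ → Finset (Fin K) → List (Fin K)} (hord : IsPullOrder ord) (hK : 2 ≤ K)
    {istar : Fin K} {Δ : Fin K → ℝ}
    (hΔ : ∀ i, Δ i = meanReward P r istar - meanReward P r i) (hpos : ∀ i ≠ istar, 0 < Δ i)
    {q : ℝ} (hq : q ∈ Set.Ioc (0 : ℝ) 1) {D : ℕ}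
    (hD : ∀ i, q ≤ P.real {ω | d 0 ω i ≤ (D : ℕ∞)}) :
    pseudoRegret P r (fun t ω => seArm T ord (fun s => r s ω) (fun s => d s ω) t) T ≤
      ∑ i ∈ Finset.univ.erase istar, 325 * Real.log T / (q * Δ i) + 4 * D := by
  have hL := half_le_log hT
  have hq0 := hq.1
  simp only [hΔ] at hpos ⊢
  have hstar : ∀ i, meanReward P r i ≤ meanReward P r istar := fun i => by
    by_cases h : i = istar
    · rw [h]
    · linarith [hpos i h]
  have hΔ1 : ∀ i, meanReward P r istar - meanReward P r i ≤ 1 := fun i => by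
    linarith [(henv.meanReward_mem istar).2, (henv.meanReward_mem i).1]
  refine (henv.pseudoRegret_le_of_isGoodPath (q := fun _ => q) (γ := fun _ => D) hT ord hstar hD
    (add_nonneg (Finset.sum_nonneg fun i hi => ?_) (by positivity)) fun ω hω =>
      hω.sum_gap_le_of_single hord hT hstar hq0 hpos hΔ1 fun _ => le_rfl).trans ?_
  · have := hpos i (Finset.ne_of_mem_erase hi)
    positivity
  · rw [add_right_comm]
    refine add_le_add ((add_le_add_right (natCast_le_sum_erase hK istar) _).trans ?_)
      (by gcongr; norm_num)
    rw [← Finset.sum_add_distrib]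
    refine Finset.sum_le_sum fun i hi => ?_
    have hp := hpos i (Finset.ne_of_mem_erase hi)
    set δ := meanReward P r istar - meanReward P r i
    have hqδ : q * δ ≤ 1 := mul_le_one₀ hq.2 hp.le (hΔ1 i)
    -- The additive `2 + 5/2` per arm is absorbed by `325 - 256 = 69`.
    have h1 : 5 ≤ 69 * Real.log T / (q * δ) := by
      rw [le_div_iff₀ (by positivity)]
      nlinarith
    have h3 : 325 * Real.log T / (q * δ) =
        256 * Real.log T / (q * δ) + 69 * Real.log T / (q * δ) := by ring
    linarith

omit [NeZero K] in
theorem le_measureReal_of_delayQuantile_le {i : Fin K} {q : ℝ} {D : ℕ}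
    (h : delayQuantile P d i q ≤ (D : ℕ∞)) : q ≤ P.real {ω | d 0 ω i ≤ (D : ℕ∞)} := by
  have hne : ((fun γ : ℕ => (γ : ℕ∞)) ''
      {γ : ℕ | q ≤ P.real {ω | d 0 ω i ≤ (γ : ℕ∞)}}).Nonempty := by
    by_contra hc
    rw [Set.not_nonempty_iff_eq_empty] at hc
    unfold delayQuantile at h
    rw [hc, sInf_empty] at h
    exact absurd h (by simp)
  -- By well-ordering the infimum is attained, so the quantile itself has the required probability.
  obtain ⟨γ, hγ, heq⟩ := csInf_mem hne
  unfold delayQuantile at h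
  rw [← heq] at h
  have hγD : γ ≤ D := by
    simpa using h
  refine le_trans hγ (measureReal_mono fun ω hω => ?_)
  exact le_trans (show d 0 ω i ≤ (γ : ℕ∞) from hω) (by exact_mod_cast hγD)

theorem pseudoRegret_nonpos_of_subsingleton [Subsingleton (Fin K)]
    (henv : IsRewardIndepDelayedBandit P r d) (T : ℕ)
    (ord : ℕ → Finset (Fin K) → List (Fin K)) (istar : Fin K) :
    pseudoRegret P r (fun t ω => seArm T ord (fun s => r s ω) (fun s => d s ω) t) T ≤ 0 := by
  refine (henv.pseudoRegret_le T ord (istar := istar) fun i => by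
    rw [Subsingleton.elim i istar]).trans (le_of_eq ?_)
  simp [Subsingleton.elim _ istar]

end Regret

end DelayedBandit

/-! ### Degenerate cases and passage to `[0,∞]`. -/

theorem mainTheorem1
    {Ω : Type*} [MeasurableSpace Ω] (P : Measure Ω) [IsProbabilityMeasure P]
    (K : ℕ) [NeZero K]
    (r : ℕ → Ω → Fin K → ℝ) (d : ℕ → Ω → Fin K → ℕ∞)
    (henv : IsRewardIndepDelayedBandit P r d)
    (ord : ℕ → Finset (Fin K) → List (Fin K)) (hord : IsPullOrder ord)
    (T : ℕ) (hT : 2 ≤ T)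
    (istar : Fin K) (hstar : ∀ i, meanReward P r i ≤ meanReward P r istar)
    (Δ : Fin K → ℝ) (hΔ : ∀ i, Δ i = meanReward P r istar - meanReward P r i)
    (R : ℝ)
    (hR : R = pseudoRegret P r (fun t ω => seArm T ord (fun s => r s ω) (fun s => d s ω) t) T) :
    (ENNReal.ofReal R ≤
      ⨅ q : Fin K → Set.Ioc (0 : ℝ) 1,
        (∑ i ∈ Finset.univ.erase istar,
          ENNReal.ofReal (40 * Real.log T) / ENNReal.ofReal (Δ i) *
            (1 / ENNReal.ofReal (q i) + 1 / ENNReal.ofReal (q istar))) +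
        ENNReal.ofReal (Real.log K) *
          ⨆ i ∈ Finset.univ.erase istar,
            ((delayQuantile P d i (q i) + delayQuantile P d istar (q istar) : ℕ∞) : ℝ≥0∞) *
              ENNReal.ofReal (Δ i)) ∧
    (ENNReal.ofReal R ≤
      ⨅ q : Set.Ioc (0 : ℝ) 1,
        (∑ i ∈ Finset.univ.erase istar,
          ENNReal.ofReal (325 * Real.log T) / (ENNReal.ofReal q * ENNReal.ofReal (Δ i))) +
        4 * ⨆ i : Fin K, ((delayQuantile P d i q : ℕ∞) : ℝ≥0∞)) := by
  rcases Nat.lt_or_ge K 2 with hK | hK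
  · have hK1 : K = 1 := by have := NeZero.ne K; omega
    subst hK1
    have h0 : ENNReal.ofReal R = 0 := ENNReal.ofReal_of_nonpos (by
      rw [hR]; exact pseudoRegret_nonpos_of_subsingleton henv T ord istar)
    rw [h0]
    exact ⟨zero_le, zero_le⟩
  have hL : 0 < Real.log T := by linarith [half_le_log hT]
  -- A second optimal arm makes both right-hand sides infinite, because `log T > 0`.
  by_cases hzero : ∃ i ∈ Finset.univ.erase istar, Δ i = 0
  · obtain ⟨i, hi, hi0⟩ := hzero
    have hterm : ∀ c : ℝ, 0 < c → ENNReal.ofReal (c * Real.log T) / 0 = ⊤ := fun c hc =>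
      ENNReal.div_zero (ENNReal.ofReal_pos.2 (mul_pos hc hL)).ne'
    refine ⟨le_iInf fun q => ?_, le_iInf fun q => ?_⟩
    · refine le_top.trans (le_trans (le_of_eq ?_) le_self_add)
      refine (ENNReal.sum_eq_top.2 ⟨i, hi, ?_⟩).symm
      rw [hi0, ENNReal.ofReal_zero, hterm 40 (by norm_num)]
      exact ENNReal.top_mul (by simp)
    · refine le_top.trans (le_trans (le_of_eq ?_) le_self_add)
      refine (ENNReal.sum_eq_top.2 ⟨i, hi, ?_⟩).symm
      rw [hi0, ENNReal.ofReal_zero, mul_zero, hterm 325 (by norm_num)]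
  have hpos : ∀ i ≠ istar, 0 < Δ i := by
    intro i hi
    refine lt_of_le_of_ne ?_ fun h => hzero ⟨i, by simpa using hi, h.symm⟩
    rw [hΔ]
    linarith [hstar i]
  refine ⟨le_iInf fun q => ?_, le_iInf fun q => ?_⟩
  · set S : ℝ≥0∞ := ⨆ i ∈ Finset.univ.erase istar,
      ((delayQuantile P d i (q i) + delayQuantile P d istar (q istar) : ℕ∞) : ℝ≥0∞) *
        ENNReal.ofReal (Δ i) with hS
    have hlogK : 0 < Real.log K := Real.log_pos (by exact_mod_cast hK)
    by_cases hStop : S = ⊤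
    · rw [hStop, ENNReal.mul_top (ENNReal.ofReal_pos.2 hlogK).ne', add_top]
      exact le_top
    have hle : ∀ i ≠ istar, ((delayQuantile P d i (q i) + delayQuantile P d istar (q istar) : ℕ∞) :
        ℝ≥0∞) * ENNReal.ofReal (Δ i) ≤ S := fun i hi =>
      le_iSup₂_of_le i (by simpa using hi) le_rfl
    have hfin' : ∀ i ≠ istar,
        delayQuantile P d i (q i) + delayQuantile P d istar (q istar) ≠ ⊤ := by
      intro i hi htop
      have h := hle i hi
      rw [htop, ENat.toENNReal_top, ENNReal.top_mul (ENNReal.ofReal_pos.2 (hpos i hi)).ne'] at h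
      exact hStop (top_le_iff.1 h)
    -- The quantile of the optimal arm appears in the maximum only paired with a suboptimal arm,
    -- which exists as `2 ≤ K`.
    have hfin : ∀ i, delayQuantile P d i (q i) ≠ ⊤ := by
      intro i
      by_cases hi : i = istar
      · have : Nontrivial (Fin K) := Fin.nontrivial_iff_two_le.2 hK
        obtain ⟨j, hj⟩ := exists_ne istar
        rw [hi]
        intro h
        exact hfin' j hj (by rw [h, add_top])
      · intro h
        exact hfin' i hi (by rw [h, top_add])
    lift (fun i => delayQuantile P d i (q i)) to Fin K → ℕ using hfin with γ hγ
    have hγ' : ∀ i, delayQuantile P d i (q i) = (γ i : ℕ∞) := fun i => (congrFun hγ i).symm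
    have hB : ∀ i ≠ istar, (γ i + γ istar : ℕ) * Δ i ≤ S.toReal := by
      intro i hi
      have h := ENNReal.toReal_mono hStop (hle i hi)
      rw [hγ', hγ', ENNReal.toReal_mul, ENNReal.toReal_ofReal (hpos i hi).le] at h
      refine le_trans (le_of_eq ?_) h
      rw [← Nat.cast_add, ENat.toENNReal_coe, ENNReal.toReal_natCast]
    have hmain := henv.pseudoRegret_le_quantiles hT hord hK hΔ hpos (q := fun i => q i)
      (fun i => (q i).2) (γ := γ) (fun i => le_measureReal_of_delayQuantile_le (hγ' i).le)
      ENNReal.toReal_nonneg hB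
    rw [← hR] at hmain
    refine (ENNReal.ofReal_le_ofReal hmain).trans ?_
    refine ENNReal.ofReal_add_le.trans (add_le_add ?_ ?_)
    · have hq : ∀ i, 0 < (q i : ℝ) := fun i => (q i).2.1
      rw [ENNReal.ofReal_sum_of_nonneg fun i hi => by
        have := hpos i (Finset.ne_of_mem_erase hi)
        have := hq i
        have := hq istar
        positivity]
      refine Finset.sum_le_sum fun i hi => ?_
      have hp := hpos i (Finset.ne_of_mem_erase hi)
      have h1 := hq i
      have h2 := hq istar
      rw [ENNReal.ofReal_mul (by positivity), ENNReal.ofReal_div_of_pos hp,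
        ENNReal.ofReal_add (by positivity) (by positivity), ENNReal.ofReal_div_of_pos h1,
        ENNReal.ofReal_div_of_pos h2, ENNReal.ofReal_one]
    · rw [ENNReal.ofReal_mul hlogK.le, ENNReal.ofReal_toReal hStop]
  · set S : ℝ≥0∞ := ⨆ i : Fin K, ((delayQuantile P d i q : ℕ∞) : ℝ≥0∞) with hS
    by_cases hStop : S = ⊤
    · rw [hStop, ENNReal.mul_top (by norm_num), add_top]
      exact le_top
    obtain ⟨i₀, hi₀⟩ := Finite.exists_max fun i => delayQuantile P d i q
    have hle : ((delayQuantile P d i₀ q : ℕ∞) : ℝ≥0∞) ≤ S :=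
      le_iSup (fun i => ((delayQuantile P d i q : ℕ∞) : ℝ≥0∞)) i₀
    have hfin : delayQuantile P d i₀ q ≠ ⊤ := by
      intro h
      rw [h, ENat.toENNReal_top] at hle
      exact hStop (top_le_iff.1 hle)
    obtain ⟨D, hD⟩ := ENat.ne_top_iff_exists.1 hfin
    rw [← hD, ENat.toENNReal_coe] at hle
    have hmain := henv.pseudoRegret_le_single_quantile hT hord hK hΔ hpos q.2 (D := D)
      (fun i => le_measureReal_of_delayQuantile_le ((hi₀ i).trans hD.symm.le))
    rw [← hR] at hmain
    refine (ENNReal.ofReal_le_ofReal hmain).trans ?_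
    refine ENNReal.ofReal_add_le.trans (add_le_add ?_ ?_)
    · have hq : 0 < (q : ℝ) := q.2.1
      rw [ENNReal.ofReal_sum_of_nonneg fun i hi => by
        have := hpos i (Finset.ne_of_mem_erase hi)
        positivity]
      refine Finset.sum_le_sum fun i hi => ?_
      have hp := hpos i (Finset.ne_of_mem_erase hi)
      rw [ENNReal.ofReal_div_of_pos (by positivity), ENNReal.ofReal_mul hq.le]
    · rw [ENNReal.ofReal_mul (by norm_num), ENNReal.ofReal_natCast, ENNReal.ofReal_ofNat]
      gcongr
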